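/- Let $R=\mathbb{C}[x_1,\dots,x_n]$, let $\mathcal{A}$ be an arrangement of hypersurfaces in $\mathbb{P}^{n-1}$ given by nonzero homogeneous polynomials $f_1,\dots,f_m\in R$, and put $F=(f_1,\dots,f_m)$. Let $Q=[\operatorname{diag}(f_1,\dots,f_m)\mid \operatorname{Jac}(F)]\in R^{m\times(m+n)}$. The log-derivation module $\operatorname{Der}_{\log}(\mathcal{A})\subseteq R^m$ is the image of $\ker Q\subseteq R^m\oplus R^n$ under projection to $R^m$. The arrangement $\mathcal{A}$ is *free* if $\operatorname{Der}_{\log}(\mathcal{A})$ is a free $R$-module. Let $I_0\subseteq R[s]=\mathbb{C}[x_1,\dots,x_n,s_1,\dots,s_m]$ be the ideal generated by all $\sum_i a_is_i$ with $a\in\operatorname{Der}_{\log}(\mathcal{A})$, so that $R[s]/I_0$ is the symmetric algebra of the likelihood module $M=R^m/\operatorname{Der}_{\log}(\mathcal{A})$. The arrangement $\mathcal{A}$ is *gentle* if $M$ is of linear type, that is, if $R[s]/I_0$ has no $R$-torsion. Let $X\subseteq\mathbb{C}^m$ be the Zariski closure of the image of $F:\mathbb{C}^n\to\mathbb{C}^m$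 and $X_{\mathrm{reg}}$ its set of nonsingular points. The likelihood ideal $I(\mathcal{A})\subseteq R[s]$ is the ideal of all polynomials vanishing at every $(x,s)\in\mathbb{C}^n\times\mathbb{C}^m$ such that $f_i(x)\neq0$ for all $i$, $F(x)\in X_{\mathrm{reg}}$, and $\sum_i s_i\,\frac{\partial f_i/\partial x_j(x)}{f_i(x)}=0$ for $j=1,\dots,n$. It is the bihomogeneous ideal of the likelihood correspondence $\mathcal{L}_{\mathcal{A}}\subseteq\mathbb{P}^{n-1}\times\mathbb{P}^{m-1}$. Give $R[s]$ the bigrading $\deg x_j=(1,0)$, $\deg s_i=(0,1)$, let $K(p,u)$ be the polynomial for which the bigraded Hilbert series of $R[s]/I(\mathcal{A})$ is $K(p,u)/\big((1-p)^n(1-u)^m\big)$, and let $c=\operatorname{codim} I(\mathcal{A})$. The multidegree of $\mathcal{L}_{\mathcal{A}}$ is the part $\sum_{i=0}^{c} c_i\,p^iu^{c-i}$ of total degree $c$ of $K(1-p,1-u)$, and the *ML degree* $\operatorname{MLdeg}(\mathcal{A})$ is its leading coefficient, that is, $c_i$ for the largest $i$ with $c_i>0$. Suppose that $\mathcal{A}$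 is free and gentle, and let $A\in R^{m\times l}$ be a matrix whose columns form a minimal system of homogeneous generators of $\operatorname{Der}_{\log}(\mathcal{A})$ (so that $M=\operatorname{coker}A$), the $j$-th column having entries homogeneous of degree $d_j$. Then $$\operatorname{MLdeg}(\mathcal{A})=\prod_{j\,:\,d_j>0}d_j .$$ -/

import Mathlib

noncomputable section

namespace LikelihoodArrangement

open MvPolynomial

/-- An arrangement of hypersurfaces in `ℙ^(n-1)`, given by nonzero homogeneous polynomials
`f₁, …, fₘ` in `R = ℂ[x₁, …, xₙ]`. No coprimality or reducedness is required. -/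
structure Arrangement (n m : ℕ) where
  f : Fin m → MvPolynomial (Fin n) ℂ
  homogeneous : ∀ i, ∃ e : ℕ, (f i).IsHomogeneous e
  ne_zero : ∀ i, f i ≠ 0

/-- The bigraded ring `R[s] = ℂ[x₁, …, xₙ, s₁, …, sₘ]`; `Sum.inl j` indexes `xⱼ` and `Sum.inr i`
indexes `sᵢ`. -/
abbrev BiRing (n m : ℕ) : Type := MvPolynomial (Fin n ⊕ Fin m) ℂ

namespace Arrangement

variable {n m : ℕ} (𝒜 : Arrangement n m)

/-! ### Logarithmic derivations, the pre-likelihood ideal, gentleness -/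

/-- The `m × (m + n)` matrix `Q = [diag(f₁, …, fₘ) | Jac(F)]`. -/
def Q : Matrix (Fin m) (Fin m ⊕ Fin n) (MvPolynomial (Fin n) ℂ) :=
  Matrix.fromCols (Matrix.diagonal 𝒜.f) (Matrix.of fun i j => pderiv j (𝒜.f i))

/-- The log-derivation module: the projection of `ker Q ⊆ R^m ⊕ R^n` to `R^m`. It is the image
of the matrix `A` whenever the columns of the stacked matrix `(A; B)` generate `ker Q`. -/
def logDer : Submodule (MvPolynomial (Fin n) ℂ) (Fin m → MvPolynomial (Fin n) ℂ) :=
  (LinearMap.ker 𝒜.Q.mulVecLin).map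
    (LinearMap.funLeft (MvPolynomial (Fin n) ℂ) (MvPolynomial (Fin n) ℂ) Sum.inl)

/-- `𝒜` is free if its log-derivation module is a free `R`-module. -/
def IsFree : Prop := Module.Free (MvPolynomial (Fin n) ℂ) 𝒜.logDer

/-- The inclusion `R → R[s]`. -/
def incl (n m : ℕ) : MvPolynomial (Fin n) ℂ →ₐ[ℂ] BiRing n m := rename Sum.inl

/-- The pre-likelihood ideal `I₀`, generated by the linear forms `∑ aᵢ sᵢ` for `a ∈ im A`.
The quotient `R[s]/I₀` is the symmetric algebra of the likelihood module
`M = coker A = R^m / logDer`. -/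
def preLikelihoodIdeal : Ideal (BiRing n m) :=
  Ideal.span ((fun a : Fin m → MvPolynomial (Fin n) ℂ =>
    ∑ i, incl n m (a i) * X (Sum.inr i)) '' (𝒜.logDer : Set (Fin m → MvPolynomial (Fin n) ℂ)))

/-- The Rees ideal of the likelihood module: the kernel of the composition
`R[s] → Sym M → Sym M / (R-torsion)`. -/
def reesIdeal : Ideal (BiRing n m) where
  carrier := {g | ∃ r : MvPolynomial (Fin n) ℂ, r ≠ 0 ∧ incl n m r * g ∈ 𝒜.preLikelihoodIdeal}
  zero_mem' := ⟨1, one_ne_zero, by simp⟩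
  add_mem' := by
    rintro g h ⟨r, hr, hg⟩ ⟨t, ht, hh⟩
    refine ⟨r * t, mul_ne_zero hr ht, ?_⟩
    have h₁ := Ideal.mul_mem_left _ (incl n m t) hg
    have h₂ := Ideal.mul_mem_left _ (incl n m r) hh
    have h₃ := Ideal.add_mem _ h₁ h₂
    rw [map_mul]
    convert h₃ using 1
    ring
  smul_mem' := by
    rintro c g ⟨r, hr, hg⟩
    refine ⟨r, hr, ?_⟩
    have h₁ := Ideal.mul_mem_left _ c hg
    rw [smul_eq_mul]
    convert h₁ using 1
    ring

/-- `𝒜` is gentle if its likelihood module is of linear type, i.e. the symmetric algebra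
`R[s]/I₀` has no `R`-torsion and so agrees with the Rees algebra. -/
def IsGentle : Prop := 𝒜.reesIdeal = 𝒜.preLikelihoodIdeal

/-! ### The likelihood correspondence -/

/-- The map `F = (f₁, …, fₘ) : ℂⁿ → ℂᵐ`. -/
def F (x : Fin n → ℂ) : Fin m → ℂ := fun i => eval x (𝒜.f i)

/-- The vanishing ideal of `X`, the Zariski closure of the image of `F`. -/
def imageIdeal : Ideal (MvPolynomial (Fin m) ℂ) := vanishingIdeal ℂ (Set.range 𝒜.F)

/-- The Zariski tangent space of `X` at a point `y`, as a subspace of `ℂᵐ`. -/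
def tangentSpace (y : Fin m → ℂ) : Submodule ℂ (Fin m → ℂ) where
  carrier := {v | ∀ g ∈ 𝒜.imageIdeal, ∑ i, eval y (pderiv i g) * v i = 0}
  zero_mem' := by intro g _; simp
  add_mem' := by
    intro v w hv hw g hg
    simp only [Pi.add_apply, mul_add, Finset.sum_add_distrib, hv g hg, hw g hg, add_zero]
  smul_mem' := by
    intro c v hv g hg
    have h : ∀ i, eval y (pderiv i g) * (c • v) i = c * (eval y (pderiv i g) * v i) := by
      intro i; simp only [Pi.smul_apply, smul_eq_mul]; ring
    simp only [h, ← Finset.mul_sum, hv g hg, mul_zero]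

/-- The set `X_reg` of nonsingular points of `X`: the points of `X` where the dimension of the
tangent space is the dimension of `X` (`X` is irreducible, as the closure of an image of `ℂⁿ`). -/
def regularLocus : Set (Fin m → ℂ) :=
  {y | y ∈ zeroLocus ℂ 𝒜.imageIdeal ∧
    ((Module.finrank ℂ (𝒜.tangentSpace y) : ℕ) : WithBot ℕ∞) =
      ringKrullDim (MvPolynomial (Fin m) ℂ ⧸ 𝒜.imageIdeal)}

/-- The pairs `(x, s) ∈ ℂⁿ × ℂᵐ` such that `x` lies in the complement of the arrangement (where
the log-likelihood `ℓ = ∑ sᵢ log fᵢ` is defined and `f^s ≠ 0`), `F(x) ∈ X_reg`, and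
`∂ℓ/∂xⱼ (x, s) = ∑ᵢ sᵢ (∂fᵢ/∂xⱼ)(x) / fᵢ(x) = 0` for all `j`. -/
def criticalPairs : Set (Fin n ⊕ Fin m → ℂ) :=
  {p | (∀ i, eval (p ∘ Sum.inl) (𝒜.f i) ≠ 0) ∧
    (∀ j, ∑ i, p (Sum.inr i) *
      (eval (p ∘ Sum.inl) (pderiv j (𝒜.f i)) / eval (p ∘ Sum.inl) (𝒜.f i)) = 0) ∧
    𝒜.F (p ∘ Sum.inl) ∈ 𝒜.regularLocus}

/-- The likelihood ideal, that is, the vanishing ideal of the likelihood correspondence `𝓛`.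
The set `criticalPairs` is stable under independent rescaling of `x` and of `s`, so this ideal is
bihomogeneous; it cuts out the closure `𝓛` of `criticalPairs` in `ℙ^(n-1) × ℙ^(m-1)`. -/
def likelihoodIdeal : Ideal (BiRing n m) := vanishingIdeal ℂ 𝒜.criticalPairs

end Arrangement

/-! ### Multidegrees -/

section Multidegree

variable {n m : ℕ}

/-- The bigrading: `deg xⱼ = (1, 0)` and `deg sᵢ = (0, 1)`. -/
def bidegree (n m : ℕ) : Fin n ⊕ Fin m → ℕ × ℕ := Sum.elim (fun _ => (1, 0)) (fun _ => (0, 1))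

/-- The graded piece of bidegree `(a, b)` of `R[s]/I`, for a bihomogeneous ideal `I`. -/
def gradedPiece (I : Ideal (BiRing n m)) (a b : ℕ) : Submodule ℂ (BiRing n m ⧸ I) :=
  (weightedHomogeneousSubmodule ℂ (bidegree n m) (a, b)).map
    (Ideal.Quotient.mkₐ ℂ I).toLinearMap

/-- The bigraded Hilbert series of `R[s]/I` in the variables `p = X 0` and `u = X 1`. -/
def hilbertSeries (I : Ideal (BiRing n m)) : MvPowerSeries (Fin 2) ℤ :=
  fun e => (Module.finrank ℂ (gradedPiece I (e 0) (e 1)) : ℤ)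

/-- `K` is the K-polynomial of `R[s]/I`: the numerator of its Hilbert series over the denominator
`(1 - p)^n (1 - u)^m`. -/
def IsKPolynomial (I : Ideal (BiRing n m)) (K : MvPolynomial (Fin 2) ℤ) : Prop :=
  (K : MvPowerSeries (Fin 2) ℤ) =
    hilbertSeries I * (1 - MvPowerSeries.X 0) ^ n * (1 - MvPowerSeries.X 1) ^ m

open Classical in
/-- The K-polynomial of `R[s]/I`, which is unique (and `0` if there were none). -/
def kPolynomial (I : Ideal (BiRing n m)) : MvPolynomial (Fin 2) ℤ :=
  if h : ∃ K, IsKPolynomial I K then h.choose else 0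

/-- The codimension of `I`. -/
def codim (I : Ideal (BiRing n m)) : ℕ := I.height.toNat

/-- The multidegree of `R[s]/I`: the part of total degree `codim I` of `K(1 - p, 1 - u)`. -/
def multidegree (I : Ideal (BiRing n m)) : MvPolynomial (Fin 2) ℤ :=
  homogeneousComponent (codim I) (bind₁ (fun i => 1 - X i) (kPolynomial I))

/-- The coefficient `cᵢ` of `p^i u^(d-i)` in the multidegree, where `d = codim I`. -/
def multidegreeCoeff (I : Ideal (BiRing n m)) (i : ℕ) : ℤ :=
  coeff (Finsupp.single 0 i + Finsupp.single 1 (codim I - i)) (multidegree I)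

end Multidegree

/-- The ML degree: the coefficient `cᵢ` of the class of the likelihood correspondence, where `i`
is the largest index with `cᵢ > 0`. -/
def Arrangement.mlDegree {n m : ℕ} (𝒜 : Arrangement n m) : ℤ :=
  multidegreeCoeff 𝒜.likelihoodIdeal
    (sSup {i : ℕ | i ≤ codim 𝒜.likelihoodIdeal ∧ 0 < multidegreeCoeff 𝒜.likelihoodIdeal i})

/-- The columns of `A ∈ R^(m × l)` form a minimal system of homogeneous generators of the
log-derivation module, and the `j`-th column has degree `d j`. -/
structure Arrangement.IsMinimalPresentation {n m l : ℕ} (𝒜 : Arrangement n m)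
    (A : Matrix (Fin m) (Fin l) (MvPolynomial (Fin n) ℂ)) (d : Fin l → ℕ) : Prop where
  homogeneous : ∀ i j, (A i j).IsHomogeneous (d j)
  span_eq : Submodule.span (MvPolynomial (Fin n) ℂ) (Set.range A.col) = 𝒜.logDer
  minimal : ∀ j, Submodule.span (MvPolynomial (Fin n) ℂ) (A.col '' {j}ᶜ) ≠ 𝒜.logDer

end LikelihoodArrangement

end

namespace LikelihoodArrangement

open MvPolynomial

section

/-! ### Weighted homogeneous components of products -/

section WeightedComponents

variable {σ M k : Type*} [CommRing k] [AddCommMonoid M] {w : σ → M}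

/-! Freeness makes the columns of `A` a basis of the log-derivation module: by graded Nakayama, a
minimal homogeneous generating system cannot exceed the rank (`linearIndependent_of_minimal`). The
`l` linear forms `gⱼ = ∑ᵢ Aᵢⱼ sᵢ`, which generate `I₀`, are therefore independent over the fraction
field of `R`, and after inverting some nonzero `h ∈ R` they become part of a coordinate system.

This is encoded by a ring map `Ψ : R[s] → D[Y₁, …, Yₗ]` with `D` a domain and `Ψ gⱼ = Yⱼ`, such that
any `q` whose image has zero constant term lies in `I₀` up to a nonzero factor from `R`
(`exists_straightening`). Gentleness removes this factor, so `I₀` is exactly the kernel of `q ↦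
constantCoeff (Ψ q)`. Three consequences follow. `I₀` is prime. It has height `l`. And if `B` is a
set of monomials forming a basis of `R[s]/I₀`, then the products of members of `B` with monomials in
the `gⱼ` form a basis of `R[s]`. Counting this basis by bidegree gives the K-polynomial `∏ⱼ (1 -
p^dⱼ u)` (`isKPolynomial_of_straightening`).

`I₀` is also the likelihood ideal (`likelihoodIdeal_eq_preLikelihoodIdeal`). Both have the same
zeros over a dense open set of `x`, since `X` is smooth at `F(x)` for general `x`
(`exists_ne_zero_forall_mem_regularLocus`); the Nullstellensatz for the prime `I₀` and the absence
of torsion do the rest.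

Finally, substituting `1 - p` and `1 - u` turns each factor into `dⱼ p + u` plus higher terms, so
the multidegree is `∏ⱼ (dⱼ p + u)`, whose leading coefficient is the product of the positive `dⱼ`.
-/

theorem weightedHomogeneousComponent_mul_of_isWeightedHomogeneous [IsRightCancelAdd M]
    {g : MvPolynomial σ k} {e : M} (hg : IsWeightedHomogeneous w g e) (a : M)
    (p : MvPolynomial σ k) :
    weightedHomogeneousComponent w (a + e) (p * g) = weightedHomogeneousComponent w a p * g := by
  induction p using MvPolynomial.induction_on' with
  | monomial s r =>
    have hs : IsWeightedHomogeneous w (monomial s r) (Finsupp.weight w s) :=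
      isWeightedHomogeneous_monomial w s r rfl
    by_cases h : Finsupp.weight w s = a
    · subst h
      rw [(hs.mul hg).weightedHomogeneousComponent_same, hs.weightedHomogeneousComponent_same]
    · rw [(hs.mul hg).weightedHomogeneousComponent_ne, hs.weightedHomogeneousComponent_ne, zero_mul]
      · exact Ne.symm h
      · exact fun h' => h (add_right_cancel h').symm
  | add p q hp hq => rw [add_mul, map_add, hp, hq, map_add, add_mul]

theorem weightedHomogeneousComponent_mul_eq_zero
    {g : MvPolynomial σ k} {e b : M} (hg : IsWeightedHomogeneous w g e) (hb : ∀ a, a + e ≠ b)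
    (p : MvPolynomial σ k) :
    weightedHomogeneousComponent w b (p * g) = 0 := by
  induction p using MvPolynomial.induction_on' with
  | monomial s r =>
    have hs : IsWeightedHomogeneous w (monomial s r) (Finsupp.weight w s) :=
      isWeightedHomogeneous_monomial w s r rfl
    exact (hs.mul hg).weightedHomogeneousComponent_ne _ (hb _).symm
  | add p q hp hq => rw [add_mul, map_add, hp, hq, add_zero]

theorem homogeneousComponent_mul_of_isHomogeneous {g : MvPolynomial σ k} {d : ℕ}
    (hg : g.IsHomogeneous d) (e : ℕ) (p : MvPolynomial σ k) :
    homogeneousComponent e (p * g) = (if d ≤ e then homogeneousComponent (e - d) p else 0) * g := by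
  split_ifs with h
  · conv_lhs => rw [← Nat.sub_add_cancel h]
    exact weightedHomogeneousComponent_mul_of_isWeightedHomogeneous hg _ p
  · rw [zero_mul]
    exact weightedHomogeneousComponent_mul_eq_zero hg
      (fun a (ha : a + d = e) => h (ha ▸ Nat.le_add_left d a)) p

end WeightedComponents

/-! ### Minimal homogeneous generators of a free module form a basis -/

section Minimal

variable {σ k : Type*} [Field k] {m l : ℕ}

/-- In the degree `d j₀` part of the relation, column `j₀` has coefficient `c j₀`, a unit: the
right-hand side contributes only the constant term of `p j₀`, which is zero. One can then solve for
that column. -/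
theorem mem_span_of_relation {A : Matrix (Fin m) (Fin l) (MvPolynomial σ k)} {d : Fin l → ℕ}
    (hA : ∀ i j, (A i j).IsHomogeneous (d j)) (c : Fin l → k) (p : Fin l → MvPolynomial σ k)
    (hp : ∀ j, constantCoeff (p j) = 0)
    (h : ∑ j, (C (c j) : MvPolynomial σ k) • A.col j = ∑ j, p j • A.col j) {j₀ : Fin l} (hc : c j₀ ≠ 0) :
    A.col j₀ ∈ Submodule.span (MvPolynomial σ k) (A.col '' {j₀}ᶜ) := by
  classical
  -- The coefficient of column `j` in the degree `d j₀` part; the case split guards against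
  -- truncated subtraction.
  set t : (Fin l → MvPolynomial σ k) → Fin l → MvPolynomial σ k := fun p j =>
    if d j ≤ d j₀ then homogeneousComponent (d j₀ - d j) (p j) else 0 with ht
  have key : ∀ p : Fin l → MvPolynomial σ k, ∀ i,
      homogeneousComponent (d j₀) ((∑ j, p j • A.col j) i) = ∑ j, t p j * A i j := by
    intro p i
    rw [Finset.sum_apply, map_sum]
    exact Finset.sum_congr rfl fun j _ =>
      homogeneousComponent_mul_of_isHomogeneous (hA i j) (d j₀) (p j)
  have hrel : ∑ j, (t (fun j => C (c j)) j - t p j) • A.col j = 0 := by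
    funext i
    have := (key (fun j => C (c j)) i).symm.trans ((congrArg (homogeneousComponent (d j₀))
      (congrFun h i)).trans (key p i))
    simp only [Finset.sum_apply, Pi.smul_apply, smul_eq_mul, sub_mul, Finset.sum_sub_distrib,
      Matrix.col_apply, Pi.zero_apply]
    rw [this, sub_self]
  have h₀ : t (fun j => C (c j)) j₀ - t p j₀ = C (c j₀) := by
    have : coeff 0 (p j₀) = 0 := hp j₀
    simp [ht, this]
  rw [← Finset.add_sum_erase _ _ (Finset.mem_univ j₀), h₀] at hrel
  have hu : A.col j₀ = (C (c j₀)⁻¹ : MvPolynomial σ k) • ((C (c j₀) : MvPolynomial σ k) • A.col j₀) := by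
    rw [smul_smul, ← map_mul, inv_mul_cancel₀ hc, map_one, one_smul]
  rw [hu, eq_neg_of_add_eq_zero_left hrel]
  refine Submodule.smul_mem _ _ (Submodule.neg_mem _ (Submodule.sum_mem _ fun j hj => ?_))
  exact Submodule.smul_mem _ _ (Submodule.subset_span ⟨j, by simpa using hj, rfl⟩)

/-- Graded Nakayama: with more generators than the rank, some nontrivial constant combination of
them lies in the irrelevant ideal times `N`, and this makes one generator redundant. With at most
rank many generators, spanning forces independence. The auxiliary basis need not be homogeneous. -/
theorem linearIndependent_of_minimal {A : Matrix (Fin m) (Fin l) (MvPolynomial σ k)}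
    {d : Fin l → ℕ} {N : Submodule (MvPolynomial σ k) (Fin m → MvPolynomial σ k)}
    (hN : Module.Free (MvPolynomial σ k) N) (hA : ∀ i j, (A i j).IsHomogeneous (d j))
    (hspan : Submodule.span (MvPolynomial σ k) (Set.range A.col) = N)
    (hmin : ∀ j, Submodule.span (MvPolynomial σ k) (A.col '' {j}ᶜ) ≠ N) :
    LinearIndependent (MvPolynomial σ k) A.col := by
  classical
  subst hspan
  set N := Submodule.span (MvPolynomial σ k) (Set.range A.col) with hNdef
  have hfin : Module.Finite (MvPolynomial σ k) N := Module.Finite.span_of_finite _ (Set.finite_range _)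
  let v : Fin l → N := fun j => ⟨A.col j, Submodule.subset_span ⟨j, rfl⟩⟩
  have hv : Submodule.span (MvPolynomial σ k) (Set.range v) = ⊤ := by
    apply Submodule.map_injective_of_injective N.injective_subtype
    rw [Submodule.map_span, ← Set.range_comp, Submodule.map_top, Submodule.range_subtype]
    rfl
  suffices hli : LinearIndependent (MvPolynomial σ k) v from
    hli.map' N.subtype (Submodule.ker_subtype N)
  refine linearIndependent_of_top_le_span_of_card_le_finrank hv.ge ?_
  let b := Module.finBasis (MvPolynomial σ k) N
  by_contra hlt
  rw [not_le, Fintype.card_fin] at hlt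
  set r := Module.finrank (MvPolynomial σ k) N
  -- The generators modulo the irrelevant ideal: `B₀` has more columns than rows, hence a kernel
  -- vector `c`.
  let B₀ : Matrix (Fin r) (Fin l) k := fun i j => constantCoeff (b.repr (v j) i)
  obtain ⟨c, hc, hc0⟩ := Submodule.exists_mem_ne_zero_of_ne_bot
    (LinearMap.ker_ne_bot_of_finrank_lt (f := B₀.mulVecLin) (by simpa using hlt))
  obtain ⟨j₀, hj₀⟩ := Function.ne_iff.mp hc0
  have hE : ∀ i, ∃ e : Fin l → MvPolynomial σ k, ∑ j, e j • v j = b i := fun i =>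
    (Submodule.mem_span_range_iff_exists_fun _).mp (hv ▸ Submodule.mem_top)
  choose e he using hE
  let x := ∑ j, (C (c j) : MvPolynomial σ k) • v j
  have hx : ∀ i, constantCoeff (b.repr x i) = 0 := by
    intro i
    have : ∑ j, B₀ i j * c j = 0 := congrFun (LinearMap.mem_ker.mp hc) i
    simp only [x, map_sum, map_smul, Finsupp.coe_finsetSum, Finset.sum_apply, Finsupp.smul_apply,
      smul_eq_mul, map_mul, constantCoeff_C]
    simpa [B₀, mul_comm] using this
  have hx' : x = ∑ j, (∑ i, b.repr x i * e i j) • v j := by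
    conv_lhs => rw [← b.sum_repr x]
    simp_rw [← he, Finset.smul_sum, smul_smul, Finset.sum_smul]
    rw [Finset.sum_comm]
  refine hmin j₀ (le_antisymm (Submodule.span_mono (Set.image_subset_range _ _)) ?_)
  have hmem := mem_span_of_relation hA c (fun j => ∑ i, b.repr x i * e i j)
    (fun j => by simp [hx]) (by
      have := congrArg N.subtype hx'
      simpa [x, v] using this) hj₀
  rw [hNdef, Submodule.span_le]
  rintro _ ⟨j, rfl⟩
  by_cases h : j = j₀
  · exact h ▸ hmem
  · exact Submodule.subset_span ⟨j, h, rfl⟩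

end Minimal

end

section

/-! ### Straightening independent linear forms -/

/-- A matrix with independent columns over a domain has a left inverse up to a nonzero scalar. -/
theorem exists_mul_eq_smul_one {R : Type*} [CommRing R] [IsDomain R] {ι κ : Type*} [Fintype ι]
    [Fintype κ] [DecidableEq κ] {A : Matrix ι κ R} (hA : LinearIndependent R A.col) :
    ∃ (B : Matrix κ ι R) (h : R), h ≠ 0 ∧ B * A = h • (1 : Matrix κ κ R) := by
  classical
  let K := FractionRing R
  let AK : Matrix ι κ K := A.map (algebraMap R K)
  -- Independence passes to the fraction field by clearing denominators; `B` and `h` then come from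
  -- clearing denominators in a left inverse there.
  have hinj : LinearMap.ker AK.mulVecLin = ⊥ := by
    rw [LinearMap.ker_eq_bot']
    intro v hv
    obtain ⟨b, hb⟩ := IsLocalization.exist_integer_multiples_of_finite (nonZeroDivisors R) v
    choose w hw using hb
    have hb0 : algebraMap R K b ≠ 0 :=
      (map_ne_zero_iff _ (IsFractionRing.injective R K)).mpr (nonZeroDivisors.coe_ne_zero b)
    have hw0 : w = 0 := by
      rw [Fintype.linearIndependent_iff] at hA
      refine funext (hA w ?_)
      funext i
      apply IsFractionRing.injective R K
      have hv' : ∑ j, AK i j * v j = 0 := congrFun hv i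
      have : ∑ j, algebraMap R K (w j) * AK i j = 0 := by
        simp only [hw, Algebra.smul_def, mul_assoc, mul_comm (v _), ← Finset.mul_sum, hv', mul_zero]
      simpa [AK] using this
    funext j
    have := hw j
    rw [hw0, Pi.zero_apply, map_zero, Algebra.smul_def] at this
    exact (mul_eq_zero.mp this.symm).resolve_left hb0
  obtain ⟨g, hg⟩ := LinearMap.exists_leftInverse_of_injective _ hinj
  have hB : LinearMap.toMatrix' g * AK = 1 := by
    rw [← LinearMap.toMatrix'_toLin' AK, ← LinearMap.toMatrix'_comp, Matrix.toLin'_apply', hg,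
      LinearMap.toMatrix'_id]
  obtain ⟨b, hb⟩ := IsLocalization.exist_integer_multiples_of_finite (nonZeroDivisors R)
    (fun x : κ × ι => LinearMap.toMatrix' g x.1 x.2)
  choose w hw using hb
  refine ⟨Matrix.of fun j i => w (j, i), b, nonZeroDivisors.coe_ne_zero b, ?_⟩
  ext j j'
  apply IsFractionRing.injective R K
  have h1 := congrFun (congrFun hB j) j'
  simp only [Matrix.mul_apply, Matrix.of_apply, map_sum, map_mul, hw, Algebra.smul_def, mul_assoc,
    ← Finset.mul_sum, Matrix.smul_apply]
  rw [Matrix.mul_apply] at h1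
  simp only [AK, Matrix.map_apply] at h1
  rw [h1]
  simp [Matrix.one_apply, apply_ite (algebraMap R K)]

variable {n m l : ℕ}

open Arrangement (incl)

/-- The linear form `∑ᵢ Aᵢⱼ sᵢ` given by the `j`-th column of `A`. -/
noncomputable def linForm (A : Matrix (Fin m) (Fin l) (MvPolynomial (Fin n) ℂ)) (j : Fin l) : BiRing n m :=
  ∑ i, incl n m (A i j) * X (Sum.inr i)

theorem incl_ne_zero {r : MvPolynomial (Fin n) ℂ} (hr : r ≠ 0) : incl n m r ≠ 0 :=
  (map_ne_zero_iff _ (rename_injective _ Sum.inl_injective)).mpr hr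

section Straightening

variable {D : Type*} [CommRing D] (ρ : BiRing n m →+* D) (β : Fin l → Fin m → D)
  (A : Matrix (Fin m) (Fin l) (MvPolynomial (Fin n) ℂ))

/-- The ring homomorphism that fixes the `xⱼ` and maps `sᵢ` to
`sᵢ - ∑ⱼ βⱼᵢ gⱼ + ∑ⱼ βⱼᵢ Yⱼ`, where `gⱼ` is the `j`-th linear form. -/
noncomputable def straighten : BiRing n m →+* MvPolynomial (Fin l) D :=
  eval₂Hom (C.comp (ρ.comp C)) (Sum.elim (fun j => C (ρ (X (Sum.inl j))))
    (fun i => C (ρ (X (Sum.inr i)) - ∑ j, β j i * ρ (linForm A j)) + ∑ j, C (β j i) * X j))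

theorem straighten_incl (a : MvPolynomial (Fin n) ℂ) :
    straighten ρ β A (incl n m a) = C (ρ (incl n m a)) := by
  have : (straighten ρ β A).comp (incl n m : MvPolynomial (Fin n) ℂ →+* BiRing n m) =
      (C.comp ρ).comp (incl n m : MvPolynomial (Fin n) ℂ →+* BiRing n m) := by
    apply MvPolynomial.ringHom_ext
    · intro c
      simp [incl, straighten]
    · intro i
      simp [incl, straighten]
  exact RingHom.congr_fun this a

theorem straighten_X_inr (i : Fin m) :
    straighten ρ β A (X (Sum.inr i)) =
      C (ρ (X (Sum.inr i)) - ∑ j, β j i * ρ (linForm A j)) + ∑ j, C (β j i) * X j := by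
  simp [straighten]

/-- Since `β` is a left inverse of `A`, the correction terms add up to exactly `-gⱼ'`, cancelling
the constant part, and the `Y` terms collapse to the single variable `Yⱼ'`. -/
theorem straighten_linForm
    (hβ : ∀ j j', ∑ i, β j i * ρ (incl n m (A i j')) = if j = j' then 1 else 0) (j' : Fin l) :
    straighten ρ β A (linForm A j') = X j' := by
  have hsum : ∑ i, ρ (incl n m (A i j')) *
      (ρ (X (Sum.inr i)) - ∑ j, β j i * ρ (linForm A j)) = 0 := by
    have h1 : ∑ i, ρ (incl n m (A i j')) * ∑ j, β j i * ρ (linForm A j) = ρ (linForm A j') := by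
      have h2 : ∀ j, ∑ i, ρ (incl n m (A i j')) * (β j i * ρ (linForm A j)) =
          (if j = j' then 1 else 0) * ρ (linForm A j) := by
        intro j
        rw [← hβ, Finset.sum_mul]
        exact Finset.sum_congr rfl fun i _ => by ring
      simp_rw [Finset.mul_sum]
      rw [Finset.sum_comm]
      simp [h2]
    have h3 : ρ (linForm A j') = ∑ i, ρ (incl n m (A i j')) * ρ (X (Sum.inr i)) := by
      simp only [linForm, map_sum, map_mul]
    simp_rw [mul_sub]
    rw [Finset.sum_sub_distrib, h1, ← h3, sub_self]
  have h1 : straighten ρ β A (linForm A j') = C (∑ i, ρ (incl n m (A i j')) *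
      (ρ (X (Sum.inr i)) - ∑ j, β j i * ρ (linForm A j))) +
      ∑ j, C (∑ i, β j i * ρ (incl n m (A i j'))) * X j := by
    rw [linForm, map_sum]
    simp_rw [map_mul, straighten_incl, straighten_X_inr, mul_add, Finset.sum_add_distrib]
    congr 1
    · simp only [map_sum, map_mul]
    · simp_rw [Finset.mul_sum, map_sum, Finset.sum_mul]
      rw [Finset.sum_comm]
      refine Finset.sum_congr rfl fun i _ => Finset.sum_congr rfl fun j _ => ?_
      rw [map_mul]
      ring
  rw [h1, hsum]
  simp [hβ]

/-- Setting `Y = 0` leaves `sᵢ - ∑ⱼ βⱼᵢ gⱼ`, which is `sᵢ` modulo the `gⱼ`; two ring homomorphisms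
that agree on generators agree. -/
theorem constantCoeff_straighten_sub_mem (q : BiRing n m) :
    constantCoeff (straighten ρ β A q) - ρ q ∈ (Ideal.span (Set.range (linForm A))).map ρ := by
  set J := (Ideal.span (Set.range (linForm A))).map ρ
  have hcomp : (Ideal.Quotient.mk J).comp (constantCoeff.comp (straighten ρ β A)) =
      (Ideal.Quotient.mk J).comp ρ := by
    apply MvPolynomial.ringHom_ext
    · intro c
      simp [straighten]
    · rintro (j | i)
      · simp [straighten]
      · have : constantCoeff (straighten ρ β A (X (Sum.inr i))) =
            ρ (X (Sum.inr i)) - ∑ j, β j i * ρ (linForm A j) := by simp [straighten_X_inr]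
        rw [RingHom.comp_apply, RingHom.comp_apply, RingHom.comp_apply, Ideal.Quotient.eq, this,
          sub_sub_cancel_left]
        refine J.neg_mem (J.sum_mem fun j _ => J.mul_mem_left _ ?_)
        exact Ideal.mem_map_of_mem _ (Ideal.subset_span ⟨j, rfl⟩)
  rw [← Ideal.Quotient.eq]
  exact RingHom.congr_fun hcomp q

end Straightening

/-- Over a suitable domain containing the polynomial ring, independent linear forms become part of
a system of coordinates. -/
theorem exists_straightening {A : Matrix (Fin m) (Fin l) (MvPolynomial (Fin n) ℂ)}
    (hA : LinearIndependent (MvPolynomial (Fin n) ℂ) A.col) :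
    ∃ (D : Type) (_ : CommRing D) (_ : IsDomain D) (Ψ : BiRing n m →+* MvPolynomial (Fin l) D),
      (∀ j, Ψ (linForm A j) = X j) ∧ ∀ q, constantCoeff (Ψ q) = 0 →
        ∃ r : MvPolynomial (Fin n) ℂ, r ≠ 0 ∧
          incl n m r * q ∈ Ideal.span (Set.range (linForm A)) := by
  classical
  obtain ⟨B, h, hh, hBA⟩ := exists_mul_eq_smul_one hA
  have hH : incl n m h ≠ 0 := incl_ne_zero hh
  have hD : IsDomain (Localization.Away (incl n m h)) :=
    IsLocalization.isDomain_localization (powers_le_nonZeroDivisors_of_noZeroDivisors hH)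
  let ρ : BiRing n m →+* Localization.Away (incl n m h) := algebraMap _ _
  let β : Fin l → Fin m → Localization.Away (incl n m h) := fun j i =>
    ρ (incl n m (B j i)) * IsLocalization.Away.invSelf (incl n m h)
  have hβ : ∀ j j', ∑ i, β j i * ρ (incl n m (A i j')) = if j = j' then 1 else 0 := by
    intro j j'
    have h1 := congrArg (fun x => ρ (incl n m x)) (congrFun (congrFun hBA j) j')
    simp only [Matrix.mul_apply, map_sum, map_mul, Matrix.smul_apply, smul_eq_mul] at h1
    have h2 : ∑ i, β j i * ρ (incl n m (A i j')) =
        (∑ i, ρ (incl n m (B j i)) * ρ (incl n m (A i j'))) *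
          IsLocalization.Away.invSelf (incl n m h) := by
      rw [Finset.sum_mul]
      exact Finset.sum_congr rfl fun i _ => by simp only [β]; ring
    rw [h2, h1, Matrix.one_apply]
    split_ifs
    · rw [map_one, map_one, mul_one]
      exact IsLocalization.Away.mul_invSelf (incl n m h)
    · rw [map_zero, map_zero, mul_zero, zero_mul]
  refine ⟨_, inferInstance, hD, straighten ρ β A, straighten_linForm ρ β A hβ, fun q hq => ?_⟩
  -- With zero constant term, `q` lies in the extended ideal, so a power of `h` carries it into the
  -- original one.
  have hJ := constantCoeff_straighten_sub_mem ρ β A q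
  rw [hq, zero_sub, neg_mem_iff] at hJ
  rw [IsLocalization.algebraMap_mem_map_algebraMap_iff (Submonoid.powers (incl n m h))] at hJ
  obtain ⟨_, ⟨e, rfl⟩, he⟩ := hJ
  exact ⟨h ^ e, pow_ne_zero _ hh, by simpa using he⟩

/-- The pre-likelihood ideal is generated by the linear forms of any generators of the
log-derivation module. -/
theorem preLikelihoodIdeal_eq_span (𝒜 : Arrangement n m)
    {A : Matrix (Fin m) (Fin l) (MvPolynomial (Fin n) ℂ)}
    (hA : Submodule.span (MvPolynomial (Fin n) ℂ) (Set.range A.col) = 𝒜.logDer) :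
    𝒜.preLikelihoodIdeal = Ideal.span (Set.range (linForm A)) := by
  apply le_antisymm
  · rw [Arrangement.preLikelihoodIdeal, Ideal.span_le]
    rintro _ ⟨a, ha, rfl⟩
    rw [SetLike.mem_coe, ← hA] at ha
    obtain ⟨c, rfl⟩ := (Submodule.mem_span_range_iff_exists_fun _).mp ha
    have : ∑ i, incl n m ((∑ j, c j • A.col j) i) * X (Sum.inr i) =
        ∑ j, incl n m (c j) * linForm A j := by
      simp only [linForm, Finset.sum_apply, Pi.smul_apply, smul_eq_mul, map_sum, map_mul,
        Finset.sum_mul, Finset.mul_sum, Matrix.col_apply, mul_assoc]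
      exact Finset.sum_comm
    beta_reduce
    rw [this]
    exact Ideal.sum_mem _ fun j _ => Ideal.mul_mem_left _ _ (Ideal.subset_span ⟨j, rfl⟩)
  · rw [Ideal.span_le]
    rintro _ ⟨j, rfl⟩
    exact Ideal.subset_span ⟨A.col j, hA ▸ Submodule.subset_span ⟨j, rfl⟩, rfl⟩

end

section

/-! ### Ideals generated by straightened elements -/

section Straightened

variable {S D : Type*} [CommRing S] [CommRing D] {l : ℕ}
  {Ψ : S →+* MvPolynomial (Fin l) D} {g : Fin l → S}

theorem mem_span_iff_of_straightening (hg : ∀ j, Ψ (g j) = X j)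
    (hker : ∀ q, constantCoeff (Ψ q) = 0 → q ∈ Ideal.span (Set.range g)) (q : S) :
    q ∈ Ideal.span (Set.range g) ↔ constantCoeff (Ψ q) = 0 := by
  refine ⟨fun hq => ?_, hker q⟩
  have : Ideal.span (Set.range g) ≤ RingHom.ker (constantCoeff.comp Ψ) := by
    rw [Ideal.span_le]
    rintro _ ⟨j, rfl⟩
    simp [RingHom.mem_ker, hg]
  exact this hq

theorem isPrime_of_straightening [IsDomain D] (hg : ∀ j, Ψ (g j) = X j)
    (hker : ∀ q, constantCoeff (Ψ q) = 0 → q ∈ Ideal.span (Set.range g)) :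
    (Ideal.span (Set.range g)).IsPrime := by
  have : Ideal.span (Set.range g) = RingHom.ker (constantCoeff.comp Ψ) :=
    Ideal.ext fun q => mem_span_iff_of_straightening hg hker q
  rw [this]
  exact RingHom.ker_isPrime _

/-- The upper bound is Krull's height theorem. For the lower bound, pull back along `Ψ` the primes
generated by the first `k` variables: the chain is strict because `g k` enters at step `k + 1`. -/
theorem height_of_straightening [IsDomain D] [IsNoetherianRing S] (hg : ∀ j, Ψ (g j) = X j)
    (hker : ∀ q, constantCoeff (Ψ q) = 0 → q ∈ Ideal.span (Set.range g)) :
    (Ideal.span (Set.range g)).height = l := by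
  have hp := isPrime_of_straightening hg hker
  apply le_antisymm
  · refine (Ideal.height_le_card_of_mem_minimalPrimes_span (Set.finite_range g)
      (Ideal.minimalPrimes_eq_subsingleton_self (I := Ideal.span (Set.range g)) ▸
        Set.mem_singleton _)).trans ?_
    have : (Set.range g).ncard ≤ l := by
      rw [← Set.image_univ]
      exact (Set.ncard_image_le Set.finite_univ).trans (by simp [Set.ncard_univ])
    exact_mod_cast this
  · let φ : ℕ → MvPolynomial (Fin l) D →+* MvPolynomial (Fin l) D := fun k =>
      eval₂Hom C (fun j => if (j : ℕ) < k then 0 else X j)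
    have hφX : ∀ k j, φ k (X j) = if (j : ℕ) < k then 0 else X j := fun k j => by simp [φ]
    let P : ℕ → Ideal S := fun k => RingHom.ker ((φ k).comp Ψ)
    have hP : ∀ k, (P k).IsPrime := fun k => RingHom.ker_isPrime _
    have hle : ∀ k, P k ≤ P (k + 1) := by
      intro k q hq
      -- Killing `k + 1` variables factors through killing `k`, so the kernels increase.
      have hcomp : φ (k + 1) = (φ (k + 1)).comp (φ k) := by
        apply MvPolynomial.ringHom_ext
        · intro c; simp [φ]
        · intro j
          rw [RingHom.comp_apply, hφX, hφX]
          by_cases h : (j : ℕ) < k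
          · simp [h, Nat.lt_succ_of_lt h]
          · simp only [h, if_false]; rw [hφX]
      have hq' : φ k (Ψ q) = 0 := hq
      change φ (k + 1) (Ψ q) = 0
      rw [hcomp, RingHom.comp_apply, hq', map_zero]
    have hk : ∀ k ≤ l, (k : ℕ∞) ≤ (P k).height := by
      intro k
      induction k with
      | zero => simp
      | succ k ih =>
        intro hkl
        have hlt : P k < P (k + 1) := by
          refine lt_of_le_of_ne (hle k) fun h => ?_
          have h1 : g ⟨k, hkl⟩ ∈ P (k + 1) := by
            change φ (k + 1) (Ψ _) = 0
            rw [hg, hφX]; simp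
          rw [← h] at h1
          have h2 : φ k (Ψ (g ⟨k, hkl⟩)) = 0 := h1
          rw [hg, hφX] at h2
          simp at h2
        have := hP k
        have := hP (k + 1)
        calc ((k + 1 : ℕ) : ℕ∞) = k + 1 := by push_cast; rfl
          _ ≤ (P k).height + 1 := by gcongr; exact ih (Nat.le_of_succ_le hkl)
          _ ≤ _ := Ideal.height_add_one_le_of_lt_of_isPrime hlt
    refine (hk l le_rfl).trans (Ideal.height_mono fun q hq => hker q ?_)
    have hq' : φ l (Ψ q) = 0 := hq
    have hcomp : (constantCoeff : MvPolynomial (Fin l) D →+* D) = constantCoeff.comp (φ l) := by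
      apply MvPolynomial.ringHom_ext
      · intro c; simp [φ]
      · intro j
        rw [RingHom.comp_apply, hφX]
        simp
    rw [hcomp, RingHom.comp_apply, hq', map_zero]

end Straightened

/-! ### A monomial basis adapted to the powers of the ideal -/

section AdaptedBasis

variable {τ k D ρ : Type*} [Field k] [CommRing D] {l : ℕ}
  {Ψ : MvPolynomial τ k →+* MvPolynomial (Fin l) D} {g : Fin l → MvPolynomial τ k}

theorem exists_monomial_basis_quotient (I : Ideal (MvPolynomial τ k)) :
    ∃ (B : Set (τ →₀ ℕ)), LinearIndependent k
        (fun b : B => Ideal.Quotient.mkₐ k I (monomial b.1 1)) ∧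
      ⊤ ≤ Submodule.span k (Set.range fun b : B => Ideal.Quotient.mkₐ k I (monomial b.1 1)) := by
  obtain ⟨κ, a, ha, hspan, hli⟩ := exists_linearIndependent' k
    (fun b : τ →₀ ℕ => Ideal.Quotient.mkₐ k I (monomial b 1))
  refine ⟨Set.range a, ?_, ?_⟩
  · rw [← linearIndependent_equiv (Equiv.ofInjective a ha)]
    exact hli
  · have h1 : Set.range ((fun b : τ →₀ ℕ => Ideal.Quotient.mkₐ k I (monomial b 1)) ∘ a) =
        Set.range fun b : Set.range a => Ideal.Quotient.mkₐ k I (monomial b.1 1) := by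
      ext x
      simp
    rw [← h1, hspan]
    intro x _
    obtain ⟨q, rfl⟩ := Ideal.Quotient.mkₐ_surjective k I x
    rw [q.as_sum, map_sum]
    refine Submodule.sum_mem _ fun b _ => ?_
    rw [← mul_one (coeff b q), ← smul_eq_mul, ← smul_monomial, map_smul]
    exact Submodule.smul_mem _ _ (Submodule.subset_span ⟨b, rfl⟩)

/-- The product of the `b`-th monomial with the `α`-th power product of the `gⱼ`. -/
noncomputable def adaptedFamily (g : Fin l → MvPolynomial τ k) (B : Set (τ →₀ ℕ))
    (x : B × (Fin l →₀ ℕ)) : MvPolynomial τ k :=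
  monomial x.1.1 1 * ∏ j, g j ^ x.2 j

/-- Here `Ψ` replaces a regular-sequence argument: it sends the power products of the `gⱼ` to
monomials in `Y`, so coefficients can be compared one exponent at a time. -/
theorem linearIndependent_adaptedFamily (hg : ∀ j, Ψ (g j) = X j) {B : Set (τ →₀ ℕ)}
    {I : Ideal (MvPolynomial τ k)} (hker : ∀ q, constantCoeff (Ψ q) = 0 → q ∈ I)
    (hB : LinearIndependent k (fun b : B => Ideal.Quotient.mkₐ k I (monomial b.1 1))) :
    LinearIndependent k (adaptedFamily g B) := by
  classical
  have hΨ : ∀ α : Fin l →₀ ℕ, Ψ (∏ j, g j ^ α j) = monomial α 1 := by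
    intro α
    rw [map_prod]
    simp only [map_pow, hg]
    rw [monomial_eq, Finsupp.prod_fintype _ _ (by simp)]
    simp
  rw [linearIndependent_iff']
  intro s c hc
  let c' : B × (Fin l →₀ ℕ) → k := fun x => if x ∈ s then c x else 0
  suffices h : ∀ α : Fin l →₀ ℕ, ∀ b, c' (b, α) = 0 by
    intro x hx
    simpa [c', hx] using h x.2 x.1
  intro α
  -- In the coefficient of `Y^α`, terms with smaller exponent vanish by induction and those with
  -- exponent not below `α` do not contribute. What remains is the constant term of a combination of
  -- `B`, which must lie in `I`.
  induction α using WellFoundedLT.induction with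
  | ind α ih =>
  have h1 : ∑ x ∈ s, (C (c' x) * monomial x.1.1 1 : MvPolynomial τ k) * ∏ j, g j ^ x.2 j = 0 := by
    rw [← hc]
    refine Finset.sum_congr rfl fun x hx => ?_
    simp only [c', hx, if_true, adaptedFamily, C_mul', smul_mul_assoc]
  have h2 := congrArg (fun q => coeff α (Ψ q)) h1
  simp only [map_sum, map_mul, hΨ, coeff_sum, map_zero, coeff_zero] at h2
  have h3 : ∀ x ∈ s, coeff α (Ψ (C (c' x)) * Ψ (monomial x.1.1 1) * monomial x.2 1) =
      if x.2 = α then constantCoeff (Ψ (C (c' x) * monomial x.1.1 1)) else 0 := by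
    intro x _
    rw [coeff_mul_monomial', mul_one, map_mul]
    by_cases hx : x.2 = α
    · simp [hx, constantCoeff_eq]
    · rw [if_neg hx]
      split_ifs with hle
      · rw [ih x.2 (lt_of_le_of_ne hle hx)]
        simp
      · rfl
  rw [Finset.sum_congr rfl h3, ← Finset.sum_filter, ← map_sum, ← map_sum] at h2
  have h4 := hker _ h2
  rw [← Ideal.Quotient.eq_zero_iff_mem, map_sum] at h4
  rw [linearIndependent_iff'] at hB
  have hinj : Set.InjOn Prod.fst (s.filter fun x => x.2 = α : Set (B × (Fin l →₀ ℕ))) := by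
    intro x hx y hy hxy
    simp only [Finset.coe_filter, Set.mem_ofPred_eq] at hx hy
    exact Prod.ext hxy (hx.2.trans hy.2.symm)
  have h5 := hB ((s.filter fun x => x.2 = α).image Prod.fst) (fun b => c' (b, α)) (by
    rw [Finset.sum_image hinj, ← h4]
    refine Finset.sum_congr rfl fun x hx => ?_
    rw [Finset.mem_filter] at hx
    rw [← hx.2, C_mul', ← map_smul]
    rfl)
  intro b
  by_cases hb : (b, α) ∈ s
  · exact h5 b (Finset.mem_image.mpr ⟨(b, α), by simp [hb], rfl⟩)
  · simp [c', hb]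

theorem isWeightedHomogeneous_adaptedFamily {w : τ → ρ →₀ ℕ} {e : Fin l → ρ →₀ ℕ}
    (hg : ∀ j, IsWeightedHomogeneous w (g j) (e j)) {B : Set (τ →₀ ℕ)}
    (x : B × (Fin l →₀ ℕ)) : IsWeightedHomogeneous w (adaptedFamily g B x)
      (Finsupp.weight w x.1.1 + Finsupp.weight e x.2) := by
  refine (isWeightedHomogeneous_monomial w _ _ rfl).mul ?_
  have : Finsupp.weight e x.2 = ∑ j, x.2 j • e j := by
    rw [Finsupp.weight_apply, Finsupp.sum_fintype _ _ (by simp)]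
  rw [this]
  exact IsWeightedHomogeneous.prod _ _ _ fun j _ => (hg j).pow _

/-- Induction on the weight: modulo the ideal, `f` is a combination of `B`, and the remainder `∑ qⱼ
gⱼ` involves only components of the `qⱼ` of strictly smaller weight because `e j ≠ 0`. -/
theorem span_adaptedFamily {w : τ → ρ →₀ ℕ} {e : Fin l → ρ →₀ ℕ}
    (hg : ∀ j, IsWeightedHomogeneous w (g j) (e j)) (he : ∀ j, e j ≠ 0) {B : Set (τ →₀ ℕ)}
    (hB : ⊤ ≤ Submodule.span k (Set.range fun b : B =>
      Ideal.Quotient.mkₐ k (Ideal.span (Set.range g)) (monomial b.1 1))) :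
    ⊤ ≤ Submodule.span k (Set.range (adaptedFamily g B)) := by
  classical
  set W := Submodule.span k (Set.range (adaptedFamily g B)) with hW
  have hWmon : ∀ b : B, monomial b.1 (1 : k) ∈ W := fun b =>
    Submodule.subset_span ⟨(b, 0), by simp [adaptedFamily]⟩
  have hWg : ∀ q ∈ W, ∀ j, q * g j ∈ W := by
    intro q hq j
    induction hq using Submodule.span_induction with
    | mem q hq =>
      obtain ⟨x, rfl⟩ := hq
      refine Submodule.subset_span ⟨(x.1, x.2 + Finsupp.single j 1), ?_⟩
      simp only [adaptedFamily, Finsupp.add_apply, pow_add, Finset.prod_mul_distrib, mul_assoc]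
      congr 2
      rw [Finset.prod_eq_single j] <;> simp +contextual [eq_comm]
    | zero => simp
    | add p q _ _ hp hq => rw [add_mul]; exact W.add_mem hp hq
    | smul a q _ hq => rw [smul_mul_assoc]; exact W.smul_mem a hq
  have key : ∀ N : ρ →₀ ℕ, ∀ f, weightedHomogeneousComponent w N f ∈ W := by
    intro N
    induction N using WellFoundedLT.induction with
    | ind N ih =>
    intro f
    have hf : Ideal.Quotient.mkₐ k (Ideal.span (Set.range g)) f ∈ _ := hB Submodule.mem_top
    obtain ⟨c, hc⟩ := (Finsupp.mem_span_range_iff_exists_finsupp).mp hf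
    have hmem : f - c.sum (fun b a => a • monomial b.1 (1 : k)) ∈ Ideal.span (Set.range g) := by
      rw [← Ideal.Quotient.eq_zero_iff_mem, map_sub, sub_eq_zero]
      refine Eq.trans hc.symm ?_
      rw [Finsupp.sum, Finsupp.sum, map_sum]
      exact Finset.sum_congr rfl fun b _ => (map_smul (Ideal.Quotient.mkₐ k _) _ _).symm
    obtain ⟨q, hq⟩ := Ideal.mem_span_range_iff_exists_fun.mp hmem
    rw [eq_sub_iff_add_eq] at hq
    rw [← hq, map_add, map_sum, Finsupp.sum, map_sum]
    refine W.add_mem (W.sum_mem fun j _ => ?_) (W.sum_mem fun b _ => ?_)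
    · by_cases h : ∃ a, a + e j = N
      · obtain ⟨a, rfl⟩ := h
        rw [weightedHomogeneousComponent_mul_of_isWeightedHomogeneous (hg j)]
        refine hWg _ (ih a ?_ _) j
        exact lt_add_of_pos_right a (pos_iff_ne_zero.mpr (he j))
      · push Not at h
        rw [weightedHomogeneousComponent_mul_eq_zero (hg j) h]
        exact W.zero_mem
    · rw [map_smul]
      refine W.smul_mem _ ?_
      by_cases h : Finsupp.weight w b.1 = N
      · rw [(isWeightedHomogeneous_monomial w _ _ h).weightedHomogeneousComponent_same]
        exact hWmon b
      · rw [(isWeightedHomogeneous_monomial w _ _ rfl).weightedHomogeneousComponent_ne _ (Ne.symm h)]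
        exact W.zero_mem
  intro f _
  rw [f.as_sum]
  refine W.sum_mem fun b _ => ?_
  rw [← (isWeightedHomogeneous_monomial w b (coeff b f) rfl).weightedHomogeneousComponent_same]
  exact key _ _

end AdaptedBasis

end

section

/-! ### Counting series -/

section Counting

variable {ρ ι κ : Type*}

/-- The generating function of a set graded by exponents. -/
noncomputable def countSeries (δ : ι → ρ →₀ ℕ) : MvPowerSeries ρ ℤ :=
  fun e => (Nat.card {i // δ i = e} : ℤ)

theorem coeff_countSeries (δ : ι → ρ →₀ ℕ) (e : ρ →₀ ℕ) :
    MvPowerSeries.coeff e (countSeries δ) = (Nat.card {i // δ i = e} : ℤ) := rfl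

theorem countSeries_congr {δ : ι → ρ →₀ ℕ} {δ' : κ → ρ →₀ ℕ} (φ : ι ≃ κ)
    (h : ∀ i, δ' (φ i) = δ i) : countSeries δ = countSeries δ' := by
  ext e
  rw [coeff_countSeries, coeff_countSeries]
  congr 1
  exact Nat.card_congr (φ.subtypeEquiv fun i => by rw [h])

theorem finite_fiber_add_nsmul {δ : ι → ρ →₀ ℕ} (hδ : ∀ e, Finite {i // δ i = e})
    {e : ρ →₀ ℕ} (he : e ≠ 0) (a : ρ →₀ ℕ) :
    Finite {x : ι × ℕ // δ x.1 + x.2 • e = a} := by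
  obtain ⟨r, hr⟩ := Finsupp.ne_iff.mp he
  have hr : 0 < e r := Nat.pos_of_ne_zero hr
  have hfin : Set.Finite ((⋃ b ∈ Set.Iic a, {i | δ i = b}) ×ˢ Set.Iic (a r)) := by
    classical
    refine Set.Finite.prod (Set.Finite.biUnion (Set.finite_Iic a) fun b _ => hδ b) (Set.finite_Iic _)
  refine (hfin.subset ?_).to_subtype
  rintro ⟨i, k⟩ (h : δ i + k • e = a)
  refine ⟨Set.mem_biUnion (x := δ i) ?_ rfl, ?_⟩
  · rw [← h]
    exact Set.mem_Iic.mpr le_self_add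
  · have := DFunLike.congr_fun h r
    simp only [Finsupp.add_apply, Finsupp.smul_apply, smul_eq_mul] at this
    have h2 : k ≤ k * e r := Nat.le_mul_of_pos_right k hr
    exact (h2.trans (Nat.le_add_left _ _)).trans this.le

/-- A geometric series: shifting the second coordinate by one matches all pairs except those with
exponent `0`. Finiteness of the fibres matters because `Nat.card` of an infinite type is `0`. -/
theorem countSeries_add_nsmul_mul {δ : ι → ρ →₀ ℕ} (hδ : ∀ e, Finite {i // δ i = e})
    {e : ρ →₀ ℕ} (he : e ≠ 0) :
    countSeries (fun x : ι × ℕ => δ x.1 + x.2 • e) * (1 - MvPowerSeries.monomial e 1) =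
      countSeries δ := by
  ext a
  have hfin := finite_fiber_add_nsmul hδ he
  rw [mul_sub, mul_one, map_sub, MvPowerSeries.coeff_mul_monomial, mul_one, coeff_countSeries,
    coeff_countSeries, coeff_countSeries, sub_eq_iff_eq_add]
  have hsplit : Nat.card {x : ι × ℕ // δ x.1 + x.2 • e = a} =
      Nat.card {i // δ i = a} + Nat.card {x : ι × ℕ // δ x.1 + (x.2 + 1) • e = a} := by
    have hfin2 : Finite {x : ι × ℕ // δ x.1 + (x.2 + 1) • e = a} :=
      Finite.of_injective (fun x => (⟨(x.1.1, x.1.2 + 1), x.2⟩ : {x : ι × ℕ // δ x.1 + x.2 • e = a}))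
        (by rintro ⟨⟨i, k⟩, h⟩ ⟨⟨i', k'⟩, h'⟩ hh; simpa using hh)
    have := hδ a
    rw [← Nat.card_sum]
    refine Nat.card_congr
      { toFun := fun x => match x with
          | ⟨(i, 0), h⟩ => Sum.inl ⟨i, by simpa using h⟩
          | ⟨(i, k + 1), h⟩ => Sum.inr ⟨(i, k), h⟩
        invFun := fun x => match x with
          | Sum.inl ⟨i, h⟩ => ⟨(i, 0), by simpa using h⟩
          | Sum.inr ⟨(i, k), h⟩ => ⟨(i, k + 1), h⟩
        left_inv := ?_
        right_inv := ?_ }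
    · rintro ⟨⟨i, _ | k⟩, h⟩ <;> rfl
    · rintro (⟨i, h⟩ | ⟨⟨i, k⟩, h⟩) <;> rfl
  rw [hsplit]
  push_cast
  congr 1
  split_ifs with hle
  · congr 1
    refine Nat.card_congr (Equiv.subtypeEquivRight fun x => ?_)
    rw [add_smul, one_smul, ← add_assoc, eq_tsub_iff_add_eq_of_le hle]
  · have : IsEmpty {x : ι × ℕ // δ x.1 + (x.2 + 1) • e = a} := by
      refine ⟨fun x => hle ?_⟩
      rw [← x.2, add_smul, one_smul, ← add_assoc]
      exact le_add_self
    rw [Nat.card_of_isEmpty, Nat.cast_zero]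

theorem countSeries_weight_fin {l : ℕ} {e : Fin l → ρ →₀ ℕ} (he : ∀ j, e j ≠ 0)
    {δ : ι → ρ →₀ ℕ} (hδ : ∀ a, Finite {i // δ i = a}) :
    (∀ a, Finite {x : ι × (Fin l →₀ ℕ) // δ x.1 + Finsupp.weight e x.2 = a}) ∧
    countSeries (fun x : ι × (Fin l →₀ ℕ) => δ x.1 + Finsupp.weight e x.2) *
      ∏ j, (1 - MvPowerSeries.monomial (e j) 1) = countSeries δ := by
  induction l with
  | zero =>
    let φ : ι × (Fin 0 →₀ ℕ) ≃ ι := Equiv.prodUnique _ _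
    have hφ : ∀ x : ι × (Fin 0 →₀ ℕ), δ (φ x) = δ x.1 + Finsupp.weight e x.2 := by
      rintro ⟨i, α⟩
      simp [φ, Subsingleton.elim α 0]
    refine ⟨fun a => ?_, ?_⟩
    · have := hδ a
      exact Finite.of_equiv _ (φ.subtypeEquiv fun x => by rw [hφ] :
        {x : ι × (Fin 0 →₀ ℕ) // δ x.1 + Finsupp.weight e x.2 = a} ≃ {i // δ i = a}).symm
    · rw [Finset.univ_eq_empty, Finset.prod_empty, mul_one]
      exact countSeries_congr φ hφ
  | succ l ih =>
    obtain ⟨hfin, hmul⟩ := ih (e := fun j => e j.succ) (fun j => he _)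
    let c : ℕ × (Fin l →₀ ℕ) ≃ (Fin (l + 1) →₀ ℕ) :=
      { toFun := fun x => Finsupp.cons x.1 x.2
        invFun := fun x => (x 0, x.tail)
        left_inv := fun x => by simp
        right_inv := fun x => by simp }
    let φ : (ι × (Fin l →₀ ℕ)) × ℕ ≃ ι × (Fin (l + 1) →₀ ℕ) :=
      (Equiv.prodAssoc _ _ _).trans ((Equiv.refl ι).prodCongr ((Equiv.prodComm _ _).trans c))
    have hφ : ∀ x : (ι × (Fin l →₀ ℕ)) × ℕ,
        δ (φ x).1 + Finsupp.weight e (φ x).2 =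
          (δ x.1.1 + Finsupp.weight (fun j => e j.succ) x.1.2) + x.2 • e 0 := by
      rintro ⟨⟨i, α⟩, k⟩
      change δ i + Finsupp.weight e (Finsupp.cons k α) = _
      rw [Finsupp.weight_apply, Finsupp.weight_apply, Finsupp.sum_fintype _ _ (by simp),
        Finsupp.sum_fintype _ _ (by simp), Fin.sum_univ_succ]
      simp only [Finsupp.cons_zero, Finsupp.cons_succ]
      abel
    refine ⟨fun a => ?_, ?_⟩
    · have := finite_fiber_add_nsmul hfin (he 0) a
      exact Finite.of_equiv _ (φ.subtypeEquiv fun x => by rw [hφ])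
    · rw [Fin.prod_univ_succ, ← mul_assoc, ← countSeries_congr φ hφ,
        countSeries_add_nsmul_mul hfin (he 0), hmul]

/-- The Hilbert series of a polynomial ring, obtained by adjoining the variables one at a time to a
single point of weight `0`. -/
theorem countSeries_weight {σ : Type*} [Fintype σ] {e : σ → ρ →₀ ℕ} (he : ∀ j, e j ≠ 0) :
    (∀ a, Finite {x : σ →₀ ℕ // Finsupp.weight e x = a}) ∧
    countSeries (fun x : σ →₀ ℕ => Finsupp.weight e x) *
      ∏ j, (1 - MvPowerSeries.monomial (e j) 1) = 1 := by
  let ε := Fintype.equivFin σ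
  obtain ⟨hfin, hmul⟩ := countSeries_weight_fin (e := fun j => e (ε.symm j)) (fun j => he _)
    (δ := fun _ : Unit => (0 : ρ →₀ ℕ)) (fun a => inferInstance)
  let φ : Unit × (Fin (Fintype.card σ) →₀ ℕ) ≃ (σ →₀ ℕ) :=
    (Equiv.punitProd _).trans (Finsupp.domCongr ε.symm).toEquiv
  have hφ : ∀ x : Unit × (Fin (Fintype.card σ) →₀ ℕ), Finsupp.weight e (φ x) =
      0 + Finsupp.weight (fun j => e (ε.symm j)) x.2 := by
    rintro ⟨_, α⟩
    rw [zero_add, Finsupp.weight_apply, Finsupp.weight_apply, Finsupp.sum_fintype _ _ (by simp),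
      Finsupp.sum_fintype _ _ (by simp)]
    refine (Fintype.sum_equiv ε.symm _ _ fun j => ?_).symm
    simp [φ]
  refine ⟨fun a => ?_, ?_⟩
  · have := hfin a
    exact Finite.of_equiv _ (φ.subtypeEquiv fun x => by rw [hφ])
  · rw [← countSeries_congr φ hφ,
      Fintype.prod_equiv ε _ (fun j => (1 - MvPowerSeries.monomial (e (ε.symm j)) 1 :
        MvPowerSeries ρ ℤ)) (fun j => by simp), hmul]
    classical
    ext a
    rw [coeff_countSeries, MvPowerSeries.coeff_one]
    split_ifs with h
    · subst h
      simp
    · have : IsEmpty {i : Unit // (0 : ρ →₀ ℕ) = a} := ⟨fun x => h x.2.symm⟩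
      simp

end Counting

end

section

/-! ### Hilbert series -/

section HomogeneousBasis

variable {τ k ρ ι : Type*} [Field k] {w : τ → ρ →₀ ℕ} {v : ι → MvPolynomial τ k}
  {δ : ι → ρ →₀ ℕ}

theorem weightedHomogeneousSubmodule_eq_span (hδ : ∀ i, IsWeightedHomogeneous w (v i) (δ i))
    (hv : ⊤ ≤ Submodule.span k (Set.range v)) (a : ρ →₀ ℕ) :
    weightedHomogeneousSubmodule k w a =
      Submodule.span k (Set.range fun i : {i // δ i = a} => v i) := by
  apply le_antisymm
  · intro f hf
    obtain ⟨c, rfl⟩ := Finsupp.mem_span_range_iff_exists_finsupp.mp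
      (hv (Submodule.mem_top (x := f)))
    rw [mem_weightedHomogeneousSubmodule] at hf
    rw [← hf.weightedHomogeneousComponent_same, Finsupp.sum, map_sum]
    refine Submodule.sum_mem _ fun i _ => ?_
    rw [map_smul]
    refine Submodule.smul_mem _ _ ?_
    by_cases h : δ i = a
    · have := hδ i
      rw [h] at this
      rw [this.weightedHomogeneousComponent_same]
      exact Submodule.subset_span ⟨⟨i, h⟩, rfl⟩
    · rw [(hδ i).weightedHomogeneousComponent_ne _ (Ne.symm h)]
      exact Submodule.zero_mem _
  · rw [Submodule.span_le]
    rintro _ ⟨⟨i, rfl⟩, rfl⟩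
    exact hδ i

theorem finrank_span_range_eq_card {V : Type*} [AddCommGroup V] [Module k V] {v : ι → V}
    (hv : LinearIndependent k v) :
    Module.finrank k (Submodule.span k (Set.range v)) = Nat.card ι :=
  Module.finrank_eq_nat_card_basis (Module.Basis.span hv)

/-- Any homogeneous basis counts the dimensions of the graded pieces, and so does the monomial
basis. -/
theorem countSeries_eq_of_basis (hδ : ∀ i, IsWeightedHomogeneous w (v i) (δ i))
    (hv : ⊤ ≤ Submodule.span k (Set.range v)) (hli : LinearIndependent k v) :
    countSeries δ = countSeries fun b : τ →₀ ℕ => Finsupp.weight w b := by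
  have hli' : LinearIndependent k fun b : τ →₀ ℕ => (monomial b 1 : MvPolynomial τ k) := by
    simpa using (basisMonomials τ k).linearIndependent
  have hv' : ⊤ ≤ Submodule.span k (Set.range fun b : τ →₀ ℕ => (monomial b 1 : MvPolynomial τ k)) := by
    simpa using (basisMonomials τ k).span_eq.ge
  ext a
  rw [coeff_countSeries, coeff_countSeries]
  congr 1
  rw [← finrank_span_range_eq_card (hli.comp (Subtype.val : {i // δ i = a} → ι)
      Subtype.val_injective),
    ← finrank_span_range_eq_card (hli'.comp
      (Subtype.val : {b : τ →₀ ℕ // Finsupp.weight w b = a} → τ →₀ ℕ) Subtype.val_injective)]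
  have h1 := weightedHomogeneousSubmodule_eq_span hδ hv a
  rw [weightedHomogeneousSubmodule_eq_span (fun b => isWeightedHomogeneous_monomial w b (1 : k) rfl)
    hv' a] at h1
  exact congrArg (fun N : Submodule k (MvPolynomial τ k) => Module.finrank k N) h1.symm

end HomogeneousBasis

variable {n m l : ℕ}

/-- The bigrading, with bidegrees written as exponents of monomials in `p` and `u`. -/
noncomputable def biWeight (n m : ℕ) : Fin n ⊕ Fin m → Fin 2 →₀ ℕ :=
  Sum.elim (fun _ => Finsupp.single 0 1) (fun _ => Finsupp.single 1 1)

theorem weight_biWeight (b : Fin n ⊕ Fin m →₀ ℕ) (a : Fin 2 →₀ ℕ) :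
    Finsupp.weight (bidegree n m) b = (a 0, a 1) ↔ Finsupp.weight (biWeight n m) b = a := by
  have h1 : Finsupp.weight (bidegree n m) b =
      (∑ j, b (Sum.inl j), ∑ i, b (Sum.inr i)) := by
    rw [Finsupp.weight_apply, Finsupp.sum_fintype _ _ (by simp), Fintype.sum_sum_type]
    simp [bidegree, Prod.ext_iff, Prod.fst_sum, Prod.snd_sum]
  have h2 : Finsupp.weight (biWeight n m) b =
      Finsupp.single 0 (∑ j, b (Sum.inl j)) + Finsupp.single 1 (∑ i, b (Sum.inr i)) := by
    rw [Finsupp.weight_apply, Finsupp.sum_fintype _ _ (by simp), Fintype.sum_sum_type]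
    simp [biWeight, Finsupp.single_finsetSum]
  rw [h1, h2, Finsupp.ext_iff, Fin.forall_fin_two]
  simp

theorem gradedPiece_eq (I : Ideal (BiRing n m)) (a : Fin 2 →₀ ℕ) :
    gradedPiece I (a 0) (a 1) = (weightedHomogeneousSubmodule ℂ (biWeight n m) a).map
      (Ideal.Quotient.mkₐ ℂ I).toLinearMap := by
  have : weightedHomogeneousSubmodule ℂ (bidegree n m) (a 0, a 1) =
      weightedHomogeneousSubmodule ℂ (biWeight n m) a := by
    ext f
    rw [mem_weightedHomogeneousSubmodule, mem_weightedHomogeneousSubmodule]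
    exact forall_congr' fun b => imp_congr_right fun _ => weight_biWeight b a
  rw [gradedPiece, this]

section KPolynomial

variable {D : Type*} [CommRing D] {Ψ : BiRing n m →+* MvPolynomial (Fin l) D}
  {g : Fin l → BiRing n m} {e : Fin l → Fin 2 →₀ ℕ}

/-- The adapted basis of `R[s]` is a product of `B` with the monomials in the `gⱼ`, so the series of
`B`, which is the Hilbert series of the quotient, is that of `R[s]` times `∏ⱼ (1 - t^eⱼ)`. -/
theorem isKPolynomial_of_straightening (hΨ : ∀ j, Ψ (g j) = X j)
    (hker : ∀ q, constantCoeff (Ψ q) = 0 → q ∈ Ideal.span (Set.range g))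
    (hg : ∀ j, IsWeightedHomogeneous (biWeight n m) (g j) (e j)) (he : ∀ j, e j ≠ 0) :
    IsKPolynomial (Ideal.span (Set.range g)) (∏ j, (1 - monomial (e j) 1)) := by
  set I := Ideal.span (Set.range g)
  obtain ⟨B, hBli, hB⟩ := exists_monomial_basis_quotient I
  have hli := linearIndependent_adaptedFamily hΨ hker hBli
  have hspan := span_adaptedFamily hg he hB
  have hhom := isWeightedHomogeneous_adaptedFamily (B := B) hg
  have hw : ∀ i, biWeight n m i ≠ 0 := by
    rintro (i | i) <;> simp [biWeight]
  obtain ⟨hfin, hmon⟩ := countSeries_weight hw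
  have hfinB : ∀ a, Finite {b : B // Finsupp.weight (biWeight n m) b.1 = a} := fun a =>
    have := hfin a
    Finite.of_injective (fun b => (⟨b.1.1, b.2⟩ :
      {b : Fin n ⊕ Fin m →₀ ℕ // Finsupp.weight (biWeight n m) b = a}))
      (fun b b' h => Subtype.ext (Subtype.ext (by simpa using h)))
  have hB' := (countSeries_weight_fin he hfinB).2
  rw [countSeries_eq_of_basis hhom hspan hli] at hB'
  have hH : hilbertSeries I = countSeries fun b : B => Finsupp.weight (biWeight n m) b.1 := by
    funext a
    change (Module.finrank ℂ (gradedPiece I (a 0) (a 1)) : ℤ) = (Nat.card _ : ℤ)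
    congr 1
    rw [gradedPiece_eq, weightedHomogeneousSubmodule_eq_span hhom hspan a, Submodule.map_span,
      ← finrank_span_range_eq_card (hBli.comp
        (Subtype.val : {b : B // Finsupp.weight (biWeight n m) b.1 = a} → B)
        Subtype.val_injective)]
    refine congrArg (fun N : Submodule ℂ (BiRing n m ⧸ I) => Module.finrank ℂ N) ?_
    apply le_antisymm
    · rw [Submodule.span_le]
      rintro _ ⟨_, ⟨⟨⟨b, α⟩, hα⟩, rfl⟩, rfl⟩
      -- A basis element with a positive power of some `gⱼ` dies in the quotient; the others are the
      -- members of `B`.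
      by_cases h0 : α = 0
      · subst h0
        rw [map_zero, add_zero] at hα
        refine Submodule.subset_span ⟨⟨b, hα⟩, ?_⟩
        simp [adaptedFamily]
      · obtain ⟨j, hj⟩ := Finsupp.ne_iff.mp h0
        have hmem : adaptedFamily g B (b, α) ∈ I := by
          refine I.mul_mem_left _ (I.mem_of_dvd (Finset.dvd_prod_of_mem _ (Finset.mem_univ j)) ?_)
          exact I.pow_mem_of_mem (Ideal.subset_span ⟨j, rfl⟩) _ (Nat.pos_of_ne_zero hj)
        have : (Ideal.Quotient.mkₐ ℂ I).toLinearMap (adaptedFamily g B (b, α)) = 0 :=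
          Ideal.Quotient.eq_zero_iff_mem.mpr hmem
        rw [SetLike.mem_coe, this]
        exact Submodule.zero_mem _
    · refine Submodule.span_mono ?_
      rintro _ ⟨⟨b, hb⟩, rfl⟩
      exact ⟨_, ⟨⟨(b, 0), by simpa using hb⟩, rfl⟩, by simp [adaptedFamily]⟩
  have hden : ∏ i, (1 - MvPowerSeries.monomial (biWeight n m i) 1 : MvPowerSeries (Fin 2) ℤ) =
      (1 - MvPowerSeries.X 0) ^ n * (1 - MvPowerSeries.X 1) ^ m := by
    rw [Fintype.prod_sum_type]
    simp [biWeight, MvPowerSeries.X]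
  rw [hden] at hmon
  rw [IsKPolynomial, hH, ← hB', mul_assoc, mul_right_comm, hmon, one_mul,
    ← coeToMvPowerSeries.ringHom_apply, map_prod]
  refine Finset.prod_congr rfl fun j _ => ?_
  rw [map_sub, map_one, coeToMvPowerSeries.ringHom_apply, coe_monomial]

theorem kPolynomial_eq {I : Ideal (BiRing n m)} {K : MvPolynomial (Fin 2) ℤ}
    (hK : IsKPolynomial I K) : kPolynomial I = K := by
  have h : ∃ K, IsKPolynomial I K := ⟨K, hK⟩
  rw [kPolynomial, dif_pos h]
  exact coe_injective _ _ (h.choose_spec.trans hK.symm)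

end KPolynomial

end

section

/-! ### The multidegree of a bihomogeneous complete intersection -/

section Multidegree

theorem homogeneousComponent_eq_zero_of_mem_pow {σ R : Type*} [CommRing R] {l : ℕ}
    {p : MvPolynomial σ R} (hp : p ∈ idealOfVars σ R ^ (l + 1)) : homogeneousComponent l p = 0 := by
  classical
  rw [mem_pow_idealOfVars_iff] at hp
  ext b
  rw [coeff_homogeneousComponent, coeff_zero]
  split_ifs with h
  · by_contra hb
    have := hp b (mem_support_iff.mpr hb)
    omega
  · rfl

/-- Replacing one factor by its linear part costs one extra order of vanishing, since all other
factors already lie in the ideal of the variables. -/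
theorem prod_sub_prod_mem_pow {σ R ι : Type*} [CommRing R] (s : Finset ι)
    (P L : ι → MvPolynomial σ R) (hL : ∀ j, L j ∈ idealOfVars σ R)
    (hP : ∀ j, P j - L j ∈ idealOfVars σ R ^ 2) :
    ∏ j ∈ s, P j - ∏ j ∈ s, L j ∈ idealOfVars σ R ^ (s.card + 1) := by
  classical
  set 𝔪 := idealOfVars σ R
  have hPm : ∀ j, P j ∈ 𝔪 := fun j => by
    have := 𝔪.add_mem (Ideal.pow_le_self two_ne_zero (hP j)) (hL j)
    simpa using this
  induction s using Finset.induction_on with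
  | empty => simp
  | insert j s hj ih =>
    rw [Finset.prod_insert hj, Finset.prod_insert hj, Finset.card_insert_of_notMem hj]
    have h1 : P j * (∏ i ∈ s, P i - ∏ i ∈ s, L i) ∈ 𝔪 ^ (s.card + 1 + 1) := by
      rw [pow_succ']
      exact Ideal.mul_mem_mul (hPm j) ih
    have h2 : (P j - L j) * ∏ i ∈ s, L i ∈ 𝔪 ^ (s.card + 1 + 1) := by
      rw [add_assoc, add_comm, pow_add]
      refine Ideal.mul_mem_mul (hP j) ?_
      have := Ideal.prod_mem_prod (s := s) (I := fun _ => 𝔪) (x := L) (fun i _ => hL i)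
      simpa using this
    convert Ideal.add_mem _ h1 h2 using 1
    ring

theorem one_sub_pow_sub_mem (d : ℕ) :
    (1 - X 0 : MvPolynomial (Fin 2) ℤ) ^ d - (1 - C (d : ℤ) * X 0) ∈ idealOfVars (Fin 2) ℤ ^ 2 := by
  have hX : (X 0 : MvPolynomial (Fin 2) ℤ) ∈ idealOfVars (Fin 2) ℤ := Ideal.subset_span ⟨0, rfl⟩
  induction d with
  | zero => simp
  | succ d ih =>
    have h1 := Ideal.mul_mem_left _ (1 - X 0 : MvPolynomial (Fin 2) ℤ) ih
    have h2 : C (d : ℤ) * (X 0 * X 0 : MvPolynomial (Fin 2) ℤ) ∈ idealOfVars (Fin 2) ℤ ^ 2 :=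
      Ideal.mul_mem_left _ _ (pow_two (idealOfVars (Fin 2) ℤ) ▸ Ideal.mul_mem_mul hX hX)
    convert Ideal.add_mem _ h1 h2 using 1
    push_cast
    rw [map_add, map_one]
    ring

variable {n m l : ℕ} {I : Ideal (BiRing n m)} {d : Fin l → ℕ}

/-- The bidegree of a linear form in the `sᵢ` with coefficients of degree `d`. -/
noncomputable def linDegree (d : ℕ) : Fin 2 →₀ ℕ := Finsupp.single 0 d + Finsupp.single 1 1

/-- Each factor `1 - (1 - p)^d (1 - u)` has linear part `d p + u` and no constant term, so the
degree `l` part of the product of `l` factors is the product of the linear parts. -/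
theorem multidegree_eq (hcodim : codim I = l)
    (hK : IsKPolynomial I (∏ j, (1 - monomial (linDegree (d j)) 1))) :
    multidegree I = ∏ j, (C (d j : ℤ) * X 0 + X 1) := by
  set 𝔪 := idealOfVars (Fin 2) ℤ
  have hX : ∀ i, (X i : MvPolynomial (Fin 2) ℤ) ∈ 𝔪 := fun i => Ideal.subset_span ⟨i, rfl⟩
  rw [multidegree, kPolynomial_eq hK, hcodim, map_prod]
  have hL : ∀ j, (C (d j : ℤ) * X 0 + X 1 : MvPolynomial (Fin 2) ℤ) ∈ 𝔪 := fun j =>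
    𝔪.add_mem (𝔪.mul_mem_left _ (hX 0)) (hX 1)
  have hP : ∀ j, bind₁ (fun i : Fin 2 => (1 - X i : MvPolynomial (Fin 2) ℤ))
      (1 - monomial (linDegree (d j)) 1) - (C (d j : ℤ) * X 0 + X 1) ∈ 𝔪 ^ 2 := by
    intro j
    have h0 : monomial (linDegree (d j)) (1 : ℤ) = X 0 ^ d j * X 1 := by
      rw [linDegree, X_pow_eq_monomial, X, monomial_mul, one_mul]
    rw [map_sub, map_one, h0, map_mul, map_pow, bind₁_X_right, bind₁_X_right]
    have h1 := Ideal.mul_mem_left _ (-(1 - X 1) : MvPolynomial (Fin 2) ℤ) (one_sub_pow_sub_mem (d j))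
    have h2 : C (d j : ℤ) * (X 0 * X 1 : MvPolynomial (Fin 2) ℤ) ∈ 𝔪 ^ 2 :=
      Ideal.mul_mem_left _ _ (pow_two 𝔪 ▸ Ideal.mul_mem_mul (hX 0) (hX 1))
    convert Ideal.sub_mem _ h1 h2 using 1
    ring
  have h := homogeneousComponent_eq_zero_of_mem_pow (prod_sub_prod_mem_pow Finset.univ _ _ hL hP)
  rw [map_sub, sub_eq_zero, Finset.card_univ, Fintype.card_fin] at h
  rw [h]
  have hhom : (∏ j, (C (d j : ℤ) * X 0 + X 1 : MvPolynomial (Fin 2) ℤ)).IsHomogeneous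
      (∑ _j : Fin l, 1) := by
    refine IsHomogeneous.prod _ _ _ fun j _ => ?_
    have h1 := (isHomogeneous_C (Fin 2) (d j : ℤ)).mul (isHomogeneous_X ℤ (0 : Fin 2))
    rw [zero_add] at h1
    exact h1.add (isHomogeneous_X ℤ 1)
  rw [Finset.sum_const, Finset.card_univ, Fintype.card_fin, smul_eq_mul, mul_one] at hhom
  exact hhom.weightedHomogeneousComponent_same

theorem multidegreeCoeff_eq (hcodim : codim I = l)
    (hK : IsKPolynomial I (∏ j, (1 - monomial (linDegree (d j)) 1))) (i : ℕ) :
    multidegreeCoeff I i = ((∑ t ∈ Finset.univ.powersetCard i, ∏ j ∈ t, d j : ℕ) : ℤ) := by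
  classical
  rw [multidegreeCoeff, multidegree_eq hcodim hK, hcodim, Finset.prod_add, coeff_sum]
  have hterm : ∀ t : Finset (Fin l), coeff (Finsupp.single 0 i + Finsupp.single 1 (l - i))
      ((∏ j ∈ t, (C (d j : ℤ) * X 0)) * ∏ _j ∈ Finset.univ \ t, X 1 : MvPolynomial (Fin 2) ℤ) =
      if t.card = i then ∏ j ∈ t, (d j : ℤ) else 0 := by
    intro t
    have h1 : ((∏ j ∈ t, (C (d j : ℤ) * X 0)) * ∏ _j ∈ Finset.univ \ t, X 1 :
        MvPolynomial (Fin 2) ℤ) =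
        monomial (Finsupp.single 0 t.card + Finsupp.single 1 (l - t.card)) (∏ j ∈ t, (d j : ℤ)) := by
      rw [Finset.prod_mul_distrib, Finset.prod_const, Finset.prod_const, ← map_prod,
        Finset.card_sdiff_of_subset (Finset.subset_univ t), Finset.card_univ, Fintype.card_fin,
        X_pow_eq_monomial, X_pow_eq_monomial, C_mul_monomial, monomial_mul, mul_one, mul_one]
    rw [h1, coeff_monomial]
    congr 1
    refine propext ⟨fun h => ?_, fun h => by rw [h]⟩
    simpa using DFunLike.congr_fun h 0
  rw [Finset.sum_congr rfl fun t _ => hterm t, ← Finset.sum_filter]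
  push_cast
  refine Finset.sum_congr ?_ fun _ _ => rfl
  ext t
  simp [Finset.mem_powersetCard]

/-- The coefficients are the elementary symmetric functions of the `dⱼ`. Any index set larger than
`T` contains some `dⱼ = 0`, and at size `#T` only `T` itself contributes. -/
theorem multidegreeCoeff_sSup (hcodim : codim I = l)
    (hK : IsKPolynomial I (∏ j, (1 - monomial (linDegree (d j)) 1))) :
    multidegreeCoeff I (sSup {i : ℕ | i ≤ codim I ∧ 0 < multidegreeCoeff I i}) =
      ((∏ j with 0 < d j, d j : ℕ) : ℤ) := by
  classical
  set T : Finset (Fin l) := Finset.univ.filter fun j => 0 < d j with hT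
  have hzero : ∀ t : Finset (Fin l), ¬ t ⊆ T → ∏ j ∈ t, d j = 0 := by
    intro t ht
    obtain ⟨j, hj, hjT⟩ := Finset.not_subset.mp ht
    exact Finset.prod_eq_zero hj (by simpa [hT] using hjT)
  have hcoeff : multidegreeCoeff I T.card = ((∏ j ∈ T, d j : ℕ) : ℤ) := by
    rw [multidegreeCoeff_eq hcodim hK, Finset.sum_eq_single T]
    · intro t ht htT
      refine hzero t fun h => htT ?_
      exact Finset.eq_of_subset_of_card_le h (Finset.mem_powersetCard.mp ht).2.ge
    · intro h
      exact absurd (Finset.mem_powersetCard.mpr ⟨Finset.subset_univ _, rfl⟩) h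
  have hgreatest : IsGreatest {i : ℕ | i ≤ codim I ∧ 0 < multidegreeCoeff I i} T.card := by
    refine ⟨⟨?_, ?_⟩, ?_⟩
    · rw [hcodim]
      simpa using Finset.card_le_univ T
    · rw [hcoeff]
      exact_mod_cast Finset.prod_pos fun j hj => (Finset.mem_filter.mp hj).2
    · rintro i ⟨-, hi⟩
      by_contra hlt
      rw [multidegreeCoeff_eq hcodim hK, Finset.sum_eq_zero] at hi
      · simp at hi
      · intro t ht
        refine hzero t fun h => hlt ?_
        rw [← (Finset.mem_powersetCard.mp ht).2]
        exact Finset.card_le_card h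
  rw [hgreatest.csSup_eq, hcoeff]

end Multidegree

theorem isWeightedHomogeneous_linForm {n m l : ℕ}
    {A : Matrix (Fin m) (Fin l) (MvPolynomial (Fin n) ℂ)} {d : Fin l → ℕ}
    (hA : ∀ i j, (A i j).IsHomogeneous (d j)) (j : Fin l) :
    IsWeightedHomogeneous (biWeight n m) (linForm A j) (linDegree (d j)) := by
  refine IsWeightedHomogeneous.sum _ _ _ fun i _ => IsWeightedHomogeneous.mul ?_
    (isWeightedHomogeneous_X ℂ _ (Sum.inr i))
  intro b hb
  obtain ⟨c, rfl, hc⟩ := coeff_rename_ne_zero _ _ _ hb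
  have := hA i j hc
  rw [Finsupp.weight_apply, Finsupp.sum_fintype _ _ (by simp)] at this ⊢
  have h1 : ∀ i : Fin m, Finsupp.mapDomain Sum.inl c (Sum.inr i) = 0 := fun i =>
    Finsupp.mapDomain_of_notMem_range _ _ (by simp)
  simp only [Pi.one_apply, smul_eq_mul, mul_one] at this
  simp only [Fintype.sum_sum_type, biWeight, Sum.elim_inl, Sum.elim_inr, h1, zero_smul,
    Finset.sum_const_zero, add_zero, Finsupp.mapDomain_apply Sum.inl_injective]
  rw [← Finset.sum_smul, this]
  simp

end

section

/-! ### Dimension and differentials of affine domains -/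

section Dimension

/-- Incomparability gives one inequality; lying over and going up lift chains of primes for the
other. -/
theorem ringKrullDim_eq_of_isIntegral {R S : Type*} [CommRing R] [CommRing S] [IsDomain S]
    [Algebra R S] [Algebra.IsIntegral R S] [FaithfulSMul R S] :
    ringKrullDim S = ringKrullDim R := by
  apply le_antisymm
  · refine Order.krullDim_le_of_strictMono (PrimeSpectrum.comap (algebraMap R S)) ?_
    intro p q hpq
    exact Ideal.IsIntegral.comap_lt_comap (R := R) (I := p.asIdeal) (J := q.asIdeal) hpq
  · refine iSup_le fun L => ?_
    obtain ⟨P, -, hP, hPL⟩ := Ideal.exists_ideal_over_prime_of_isIntegral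
      (RelSeries.head L).asIdeal (⊥ : Ideal S) (by
        intro x hx
        have : algebraMap R S x = 0 := hx
        rw [FaithfulSMul.algebraMap_eq_zero_iff] at this
        rw [this]
        exact Ideal.zero_mem _)
    have hover : P.LiesOver (RelSeries.head L).asIdeal := ⟨hPL.symm⟩
    obtain ⟨L', hL', -, -⟩ := Ideal.exists_ltSeries_of_hasGoingUp L P
    rw [← hL']
    exact Order.LTSeries.length_le_krullDim L'

/-- The dimension of an affine domain over a field of characteristic zero is the dimension of the
module of differentials of its fraction field. -/
theorem ringKrullDim_eq_finrank_kaehlerDifferential (k A L : Type*) [Field k] [CharZero k]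
    [CommRing A] [IsDomain A] [Algebra k A] [Algebra.FiniteType k A] [Field L] [Algebra A L]
    [IsFractionRing A L] [Algebra k L] [IsScalarTower k A L] :
    ringKrullDim A = (Module.finrank L (Ω[L⁄k]) : ℕ) ∧ Module.Finite L (Ω[L⁄k]) := by
  -- Noether normalization: `s` is the dimension. In characteristic zero, `L` is separable over the
  -- fraction field of the polynomial subring, hence formally étale over that subring, and the `dXᵢ`
  -- become a basis of the differentials of `L`.
  obtain ⟨s, g, hg, hint⟩ := exists_integral_inj_algHom_of_fg k A
  let S := MvPolynomial (Fin s) k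
  algebraize [g.toRingHom]
  have hkSA : IsScalarTower k S A := IsScalarTower.of_algebraMap_eq fun x => (g.commutes x).symm
  have hfaith : FaithfulSMul S A := (faithfulSMul_iff_algebraMap_injective S A).mpr hg
  have hdim : ringKrullDim A = (s : ℕ) := by
    rw [ringKrullDim_eq_of_isIntegral (R := S), MvPolynomial.ringKrullDim_of_isNoetherianRing,
      ringKrullDim_eq_zero_of_field]
    simp
  let : Algebra S L := ((algebraMap A L).comp (algebraMap S A)).toAlgebra
  have hSAL : IsScalarTower S A L := IsScalarTower.of_algebraMap_eq fun x => rfl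
  have hkSL : IsScalarTower k S L := IsScalarTower.of_algebraMap_eq fun x => by
    rw [IsScalarTower.algebraMap_apply k A L, IsScalarTower.algebraMap_apply S A L,
      ← IsScalarTower.algebraMap_apply k S A]
  have hfaithL : FaithfulSMul S L := by
    rw [faithfulSMul_iff_algebraMap_injective, IsScalarTower.algebraMap_eq S A L]
    exact (IsFractionRing.injective A L).comp hg
  let K := FractionRing S
  let : Algebra K L := FractionRing.liftAlgebra S L
  have hSKL : IsScalarTower S K L := FractionRing.isScalarTower_liftAlgebra S L
  have halgA : Algebra.IsAlgebraic S A := Algebra.IsIntegral.isAlgebraic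
  have halg : Algebra.IsAlgebraic K L := by
    have h1 : Algebra.IsAlgebraic S L := (IsFractionRing.isAlgebraic_iff' S A L).mp halgA
    exact IsFractionRing.comap_isAlgebraic_iff.mp h1
  have : CharZero K := charZero_of_injective_algebraMap (R := k) (FaithfulSMul.algebraMap_injective k K)
  have h1 : Algebra.FormallyEtale K L := Algebra.FormallyEtale.of_isSeparable K L
  have h2 : Algebra.FormallyEtale S K := .of_isLocalization (nonZeroDivisors S)
  have h3 : Algebra.FormallyEtale S L := .comp S K L
  let e := KaehlerDifferential.tensorKaehlerEquivOfFormallyEtale k S L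
  let b := ((KaehlerDifferential.mvPolynomialBasis k (Fin s)).baseChange L).map e
  refine ⟨?_, Module.Finite.of_basis b⟩
  rw [hdim, Module.finrank_eq_card_basis b, Fintype.card_fin]

end Dimension

/-! ### The tangent space at the generic point, via derivations -/

section TangentSpace

variable {k A L : Type*} [Field k] [CommRing A] [Algebra k A] [Field L] [Algebra A L]
  [Algebra k L] [IsScalarTower k A L] {m : ℕ} [Algebra (MvPolynomial (Fin m) k) A]
  [IsScalarTower k (MvPolynomial (Fin m) k) A] [Algebra (MvPolynomial (Fin m) k) L]
  [IsScalarTower (MvPolynomial (Fin m) k) A L]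

variable (k A L m) in
/-- The tangent space at the generic point of the closed subscheme `Spec A` of affine space. -/
def genericTangentSpace : Submodule L (Fin m → L) where
  carrier := {v | ∀ g : MvPolynomial (Fin m) k, algebraMap _ A g = 0 →
    ∑ i, algebraMap _ L (pderiv i g) * v i = 0}
  zero_mem' := by intro g _; simp
  add_mem' := by
    intro v w hv hw g hg
    simp only [Pi.add_apply, mul_add, Finset.sum_add_distrib, hv g hg, hw g hg, add_zero]
  smul_mem' := by
    intro c v hv g hg
    simp only [Pi.smul_apply, smul_eq_mul, mul_left_comm _ c, ← Finset.mul_sum, hv g hg, mul_zero]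

theorem derivation_apply_eq_sum_pderiv [IsScalarTower k (MvPolynomial (Fin m) k) L]
    (δ : Derivation k (MvPolynomial (Fin m) k) L) (g : MvPolynomial (Fin m) k) :
    δ g = ∑ i, algebraMap _ L (pderiv i g) * δ (X i) := by
  let D : Fin m → Derivation k (MvPolynomial (Fin m) k) L := fun i =>
    (LinearMap.toSpanSingleton (MvPolynomial (Fin m) k) L (δ (X i))).compDer (pderiv i)
  have hD : ∀ g, (∑ i, D i) g = ∑ i, algebraMap _ L (pderiv i g) * δ (X i) := by
    intro g
    have := congrFun (map_sum Derivation.coeFnAddMonoidHom D Finset.univ) g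
    rw [Finset.sum_apply] at this
    refine this.trans (Finset.sum_congr rfl fun i _ => ?_)
    simp [D, Algebra.smul_def]
  have h : δ = ∑ i, D i := by
    refine derivation_ext fun j => ?_
    rw [hD]
    simp [pderiv_X, Pi.single_apply, apply_ite (algebraMap (MvPolynomial (Fin m) k) L)]
  rw [← hD, ← h]

/-- Derivations from an affine ring to a field extend to its fraction field. -/
theorem exists_derivation_extension [IsFractionRing A L] (δ : Derivation k A L) :
    ∃ δ' : Derivation k L L, ∀ a, δ' (algebraMap A L a) = δ a := by
  have : Algebra.FormallyEtale A L := .of_isLocalization (nonZeroDivisors A)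
  let e := KaehlerDifferential.tensorKaehlerEquivOfFormallyEtale k A L
  let f : TensorProduct A L (Ω[A⁄k]) →ₗ[L] L :=
    LinearMap.liftBaseChange L δ.liftKaehlerDifferential
  refine ⟨KaehlerDifferential.linearMapEquivDerivation k L (f.comp e.symm.toLinearMap), fun a => ?_⟩
  have := KaehlerDifferential.tensorKaehlerEquivOfFormallyEtale_symm_D_algebraMap k A L a
  change f (e.symm (KaehlerDifferential.D k L (algebraMap A L a))) = δ a
  rw [this]
  simp [f]

variable (k A L m) in
-- Recording the values on the coordinates identifies the derivations of `L` over `k`, the dual of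
-- the differentials, with the generic tangent space: a vector orthogonal to all gradients defines a
-- derivation that descends to `A` and extends to `L`.
theorem finrank_genericTangentSpace [IsFractionRing A L]
    (hsurj : Function.Surjective (algebraMap (MvPolynomial (Fin m) k) A)) :
    Module.finrank L (genericTangentSpace k A L m) = Module.finrank L (Ω[L⁄k]) := by
  have hkYL : IsScalarTower k (MvPolynomial (Fin m) k) L := IsScalarTower.of_algebraMap_eq fun x => by
    rw [IsScalarTower.algebraMap_apply (MvPolynomial (Fin m) k) A L,
      ← IsScalarTower.algebraMap_apply k _ A, ← IsScalarTower.algebraMap_apply k A L]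
  have : IsDomain A := (IsFractionRing.injective A L).isDomain
  let E : Derivation k L L →ₗ[L] (Fin m → L) :=
    { toFun := fun δ i => δ (algebraMap _ L (X i : MvPolynomial (Fin m) k))
      map_add' := fun _ _ => rfl
      map_smul' := fun _ _ => rfl }
  have hinj : Function.Injective E := by
    rw [← LinearMap.ker_eq_bot, LinearMap.ker_eq_bot']
    intro δ hδ
    have h1 : δ.compAlgebraMap (MvPolynomial (Fin m) k) = 0 :=
      derivation_ext fun i => congrFun hδ i
    have h2 : ∀ a : A, δ (algebraMap A L a) = 0 := by
      intro a
      obtain ⟨g, rfl⟩ := hsurj a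
      rw [← IsScalarTower.algebraMap_apply]
      exact congrArg (fun D : Derivation k (MvPolynomial (Fin m) k) L => D g) h1
    ext x
    obtain ⟨a, b, hb, rfl⟩ := IsFractionRing.div_surjective (A := A) x
    have hb0 : algebraMap A L b ≠ 0 := IsFractionRing.to_map_ne_zero_of_mem_nonZeroDivisors hb
    have h3 := δ.leibniz (algebraMap A L b) (algebraMap A L a / algebraMap A L b)
    rw [mul_div_cancel₀ _ hb0, h2, h2, smul_zero, add_zero, smul_eq_mul] at h3
    exact (mul_eq_zero.mp h3.symm).resolve_left hb0
  have hrange : LinearMap.range E = genericTangentSpace k A L m := by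
    apply le_antisymm
    · rintro _ ⟨δ, rfl⟩ g hg
      have h1 := derivation_apply_eq_sum_pderiv (δ.compAlgebraMap (MvPolynomial (Fin m) k)) g
      have h2 : δ.compAlgebraMap (MvPolynomial (Fin m) k) g = 0 := by
        change δ (algebraMap _ L g) = 0
        rw [IsScalarTower.algebraMap_apply _ A L, hg, map_zero, map_zero]
      exact h1.symm.trans h2
    · intro v hv
      let d₀ : Derivation k (MvPolynomial (Fin m) k) L := mkDerivation k v
      have hd₀ : ∀ g, algebraMap _ A g = 0 → d₀ g = 0 := by
        intro g hg
        rw [derivation_apply_eq_sum_pderiv]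
        simpa [d₀] using hv g hg
      have hd₁ : ∀ g g', algebraMap _ A g = algebraMap _ A g' → d₀ g = d₀ g' := by
        intro g g' h
        rw [← sub_eq_zero, ← map_sub]
        exact hd₀ _ (by rw [map_sub, h, sub_self])
      -- A set-theoretic section; `hd₁` makes the choice of representatives irrelevant.
      let r : A → MvPolynomial (Fin m) k := Function.surjInv hsurj
      have hr : ∀ a, algebraMap _ A (r a) = a := Function.surjInv_eq hsurj
      let d₁ : A →ₗ[k] L :=
        { toFun := fun a => d₀ (r a)
          map_add' := fun a b => by
            rw [← map_add]
            exact hd₁ _ _ (by rw [map_add, hr, hr, hr])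
          map_smul' := fun c a => by
            rw [RingHom.id_apply, ← d₀.map_smul]
            refine hd₁ _ _ ?_
            rw [Algebra.smul_def, Algebra.smul_def, map_mul, hr, hr,
              ← IsScalarTower.algebraMap_apply] }
      obtain ⟨δ, hδ⟩ := exists_derivation_extension (Derivation.mk' d₁ fun a b => by
        have h1 : ∀ a : A, ∀ x : L, r a • x = a • x := fun a x => by
          rw [Algebra.smul_def, Algebra.smul_def, IsScalarTower.algebraMap_apply _ A L, hr]
        have h2 : d₁ (a * b) = d₀ (r a * r b) := hd₁ _ _ (by rw [map_mul, hr, hr, hr])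
        rw [h2, d₀.leibniz, h1, h1]
        rfl)
      refine ⟨δ, funext fun i => ?_⟩
      change δ (algebraMap _ L (X i : MvPolynomial (Fin m) k)) = v i
      rw [IsScalarTower.algebraMap_apply _ A L, hδ]
      change d₀ (r _) = v i
      rw [hd₁ _ (X i) (hr _)]
      exact mkDerivation_X _ _ _
  rw [← hrange, LinearMap.finrank_range_of_inj hinj,
    ← (KaehlerDifferential.linearMapEquivDerivation k L (M := L)).finrank_eq]
  exact Subspace.dual_finrank_eq

end TangentSpace

end

section

/-! ### The image closure is regular at generic points of the image -/

section Specialization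

theorem linearIndependent_col_of_map {R L : Type*} [CommRing R] [CommRing L] [Algebra R L]
    [FaithfulSMul R L] {ι κ : Type*} [Fintype κ] {A : Matrix ι κ R}
    (hA : LinearIndependent L (A.map (algebraMap R L)).col) : LinearIndependent R A.col := by
  rw [Fintype.linearIndependent_iff] at hA ⊢
  intro c hc j
  apply FaithfulSMul.algebraMap_injective R L
  rw [map_zero]
  refine hA (fun j => algebraMap R L (c j)) ?_ j
  funext i
  simpa [Algebra.smul_def] using congrArg (algebraMap R L) (congrFun hc i)

/-- The identity `B A = h • 1` survives specialization, and still gives a left inverse wherever `h`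
does not vanish. -/
theorem exists_ne_zero_linearIndependent_map {R : Type*} [CommRing R] [IsDomain R] {ι κ : Type*}
    [Fintype ι] [Fintype κ] {A : Matrix ι κ R} (hA : LinearIndependent R A.col) :
    ∃ h : R, h ≠ 0 ∧ ∀ φ : R →+* ℂ, φ h ≠ 0 → LinearIndependent ℂ (A.map φ).col := by
  classical
  obtain ⟨B, h, hh, hBA⟩ := exists_mul_eq_smul_one hA
  refine ⟨h, hh, fun φ hφ => ?_⟩
  have hmap : B.map φ * A.map φ = φ h • (1 : Matrix κ κ ℂ) := by
    rw [← Matrix.map_mul, hBA]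
    ext i j
    simp [Matrix.one_apply, apply_ite φ]
  rw [← Matrix.mulVec_injective_iff]
  intro v w hvw
  have h1 : (B.map φ * A.map φ).mulVec v = (B.map φ * A.map φ).mulVec w := by
    rw [← Matrix.mulVec_mulVec, ← Matrix.mulVec_mulVec]
    exact congrArg _ hvw
  rw [hmap, Matrix.smul_mulVec, Matrix.smul_mulVec, Matrix.one_mulVec, Matrix.one_mulVec] at h1
  exact smul_right_injective _ hφ h1

theorem transpose_mulVecLin_apply {K : Type*} [CommSemiring K] {m r : ℕ}
    (G : Matrix (Fin m) (Fin r) K) (w : Fin m → K) (j : Fin r) :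
    G.transpose.mulVecLin w j = ∑ i, G i j * w i := rfl

theorem finrank_ker_transpose_add {K : Type*} [Field K] {m r : ℕ} {G : Matrix (Fin m) (Fin r) K}
    (hG : LinearIndependent K G.col) :
    Module.finrank K (LinearMap.ker G.transpose.mulVecLin) + r = m := by
  have h1 := LinearMap.finrank_range_add_finrank_ker G.transpose.mulVecLin
  have h2 : G.transpose.rank = r := by
    have := LinearIndependent.rank_matrix (M := G.transpose) hG
    simpa using this
  rw [Matrix.rank] at h2
  rw [h2] at h1
  simpa [add_comm] using h1

end Specialization

variable {n m : ℕ} (𝒜 : Arrangement n m)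

theorem eval_F (x : Fin n → ℂ) (g : MvPolynomial (Fin m) ℂ) :
    eval (𝒜.F x) g = eval x (aeval 𝒜.f g) := by
  have h : (aeval (𝒜.F x) : MvPolynomial (Fin m) ℂ →ₐ[ℂ] ℂ) = (aeval x).comp (aeval 𝒜.f) := by
    apply MvPolynomial.algHom_ext
    intro i
    simp [Arrangement.F, aeval_eq_eval]
  have := DFunLike.congr_fun h g
  simpa [aeval_eq_eval] using this

theorem mem_imageIdeal_iff (g : MvPolynomial (Fin m) ℂ) :
    g ∈ 𝒜.imageIdeal ↔ aeval 𝒜.f g = 0 := by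
  rw [Arrangement.imageIdeal, mem_vanishingIdeal_iff, Set.forall_mem_range]
  simp only [aeval_eq_eval, eval_F]
  constructor
  · intro h
    exact MvPolynomial.funext fun x => by simpa using h x
  · intro h x
    rw [h, map_zero]

instance isPrime_imageIdeal : 𝒜.imageIdeal.IsPrime := by
  have : 𝒜.imageIdeal = RingHom.ker (aeval 𝒜.f : MvPolynomial (Fin m) ℂ →ₐ[ℂ] _) :=
    Ideal.ext fun g => mem_imageIdeal_iff 𝒜 g
  rw [this]
  exact RingHom.ker_isPrime _

/-- Generically there are `r` independent gradients and `s = m - r = dim X` independent tangent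
vectors. Where both families stay independent, the gradients bound the tangent dimension above by
`s` and the vectors bound it below by `s`. Since this is a nonempty open condition on `X`, it pulls
back to a nonzero polynomial in `x`. -/
theorem exists_ne_zero_forall_mem_regularLocus :
    ∃ h : MvPolynomial (Fin n) ℂ, h ≠ 0 ∧ ∀ x, eval x h ≠ 0 → 𝒜.F x ∈ 𝒜.regularLocus := by
  classical
  let Y := MvPolynomial (Fin m) ℂ
  let A := Y ⧸ 𝒜.imageIdeal
  let L := FractionRing A
  have hsurj : Function.Surjective (algebraMap Y A) := Ideal.Quotient.mk_surjective
  let T := genericTangentSpace ℂ A L m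
  set s := Module.finrank L T with hs
  have hdim : ringKrullDim A = (s : ℕ) := by
    rw [hs, finrank_genericTangentSpace ℂ A L m hsurj]
    exact (ringKrullDim_eq_finrank_kaehlerDifferential ℂ A L).1
  -- equations whose gradients are independent
  let grads : Set (Fin m → L) :=
    {v | ∃ g : Y, algebraMap Y A g = 0 ∧ v = fun i => algebraMap Y L (pderiv i g)}
  obtain ⟨r, v, hv, hspan, hli⟩ : ∃ (r : ℕ) (v : Fin r → Fin m → L), (∀ i, v i ∈ grads) ∧
      Submodule.span L (Set.range v) = Submodule.span L grads ∧ LinearIndependent L v :=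
    ⟨_, Submodule.exists_fun_fin_finrank_span_eq L grads⟩
  choose g hg hvg using hv
  let G : Matrix (Fin m) (Fin r) A := Matrix.of fun i j => algebraMap Y A (pderiv i (g j))
  have hGv : (G.map (algebraMap A L)).col = v := by
    funext j i
    rw [hvg]
    exact (IsScalarTower.algebraMap_apply Y A L _).symm
  have hTker : T = LinearMap.ker (G.map (algebraMap A L)).transpose.mulVecLin := by
    ext w
    rw [LinearMap.mem_ker]
    constructor
    · intro hw
      funext j
      refine (transpose_mulVecLin_apply _ w j).trans (Eq.trans ?_ (hw (g j) (hg j)))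
      refine Finset.sum_congr rfl fun i _ => ?_
      rw [← congrFun (hvg j) i, ← hGv]
      rfl
    · intro hw g' hg'
      have h1 : Submodule.span L grads ≤
          LinearMap.ker (∑ i, w i • (LinearMap.proj i : (Fin m → L) →ₗ[L] L)) := by
        rw [← hspan, Submodule.span_le]
        rintro _ ⟨j, rfl⟩
        have h2 : ∑ i, v j i * w i = 0 := by
          rw [← hGv]
          exact congrFun hw j
        rw [SetLike.mem_coe, LinearMap.mem_ker, LinearMap.sum_apply]
        simpa [mul_comm] using h2
      have h3 := h1 (Submodule.subset_span ⟨g', hg', rfl⟩)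
      rw [LinearMap.mem_ker, LinearMap.sum_apply] at h3
      simpa [mul_comm] using h3
  have hrs : s + r = m := by
    rw [hs, hTker]
    exact finrank_ker_transpose_add (by rw [hGv]; exact hli)
  -- independent tangent vectors
  let b := Module.finBasis L T
  -- A common denominator puts the tangent vectors in the coordinate ring, where they can be
  -- evaluated at points.
  obtain ⟨a, ha⟩ := IsLocalization.exist_integer_multiples_of_finite (nonZeroDivisors A)
    (fun x : Fin m × Fin s => (b x.2 : Fin m → L) x.1)
  choose u hu using ha
  have ha0 : algebraMap A L a ≠ 0 :=
    (map_ne_zero_iff _ (IsFractionRing.injective A L)).mpr (nonZeroDivisors.coe_ne_zero a)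
  let U : Matrix (Fin m) (Fin s) A := Matrix.of fun i j => u (i, j)
  have hUcol : ∀ j, (U.map (algebraMap A L)).col j = algebraMap A L a • (b j : Fin m → L) := by
    intro j
    funext i
    refine (hu (i, j)).trans ?_
    rw [Algebra.smul_def]
    rfl
  have hUT : ∀ j, (U.map (algebraMap A L)).col j ∈ T := fun j => by
    rw [hUcol]
    exact T.smul_mem _ (b j).2
  have hUli : LinearIndependent L (U.map (algebraMap A L)).col := by
    have h1 : LinearIndependent L fun j => (b j : Fin m → L) :=
      b.linearIndependent.map' T.subtype (Submodule.ker_subtype T)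
    have h2 := h1.units_smul fun _ => Units.mk0 _ ha0
    have h3 : (U.map (algebraMap A L)).col =
        (fun _ => Units.mk0 _ ha0 : Fin s → Lˣ) • fun j => (b j : Fin m → L) :=
      funext hUcol
    rw [h3]
    exact h2
  obtain ⟨h₁, hh₁, hG⟩ := exists_ne_zero_linearIndependent_map
    (linearIndependent_col_of_map (L := L) (A := G) (by rw [hGv]; exact hli))
  obtain ⟨h₂, hh₂, hU⟩ := exists_ne_zero_linearIndependent_map
    (linearIndependent_col_of_map (L := L) (A := U) hUli)
  obtain ⟨H, hH⟩ := hsurj (h₁ * h₂)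
  refine ⟨aeval 𝒜.f H, ?_, fun x hx => ?_⟩
  · rw [Ne, ← mem_imageIdeal_iff, ← Ideal.Quotient.eq_zero_iff_mem]
    exact fun h => mul_ne_zero hh₁ hh₂ (hH.symm.trans h)
  rw [← eval_F] at hx
  have hP : ∀ q ∈ 𝒜.imageIdeal, eval (𝒜.F x) q = 0 := fun q hq => by
    rw [eval_F, (mem_imageIdeal_iff 𝒜 q).mp hq, map_zero]
  let φ : A →+* ℂ := Ideal.Quotient.lift 𝒜.imageIdeal (eval (𝒜.F x)) hP
  have hφ : ∀ q : Y, φ (algebraMap Y A q) = eval (𝒜.F x) q := fun q => Ideal.Quotient.lift_mk _ _ _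
  have hφ12 : φ h₁ * φ h₂ ≠ 0 := by rwa [← map_mul, ← hH, hφ]
  have hG' := hG φ (left_ne_zero_of_mul hφ12)
  have hU' := hU φ (right_ne_zero_of_mul hφ12)
  refine ⟨fun q hq => by simpa [aeval_eq_eval] using hP q hq, ?_⟩
  rw [hdim]
  norm_cast
  apply le_antisymm
  · have h1 : 𝒜.tangentSpace (𝒜.F x) ≤ LinearMap.ker (G.map φ).transpose.mulVecLin := by
      intro w hw
      rw [LinearMap.mem_ker]
      funext j
      refine (transpose_mulVecLin_apply _ w j).trans (Eq.trans ?_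
        (hw (g j) (Ideal.Quotient.eq_zero_iff_mem.mp (hg j))))
      exact Finset.sum_congr rfl fun i _ => congrArg (· * w i) (hφ (pderiv i (g j)))
    have h2 := Submodule.finrank_mono h1
    have h3 := finrank_ker_transpose_add hG'
    omega
  · have h1 : ∀ j, (U.map φ).col j ∈ 𝒜.tangentSpace (𝒜.F x) := by
      intro j q hq
      have h2 : ∑ i, algebraMap Y A (pderiv i q) * U i j = 0 := by
        apply IsFractionRing.injective A L
        rw [map_sum, map_zero]
        refine Eq.trans ?_ (hUT j q (Ideal.Quotient.eq_zero_iff_mem.mpr hq))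
        refine Finset.sum_congr rfl fun i _ => ?_
        rw [map_mul, ← IsScalarTower.algebraMap_apply Y A L]
        rfl
      have h3 := congrArg φ h2
      rw [map_sum, map_zero] at h3
      refine Eq.trans ?_ h3
      refine Finset.sum_congr rfl fun i _ => ?_
      rw [map_mul, hφ]
      rfl
    have h2 := finrank_span_eq_card hU'
    rw [Fintype.card_fin] at h2
    rw [← h2]
    refine Submodule.finrank_mono ?_
    rw [Submodule.span_le]
    rintro _ ⟨j, rfl⟩
    exact h1 j

end

section

variable {n m : ℕ} (𝒜 : Arrangement n m)

/-! ### The likelihood ideal of a gentle arrangement -/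

open Arrangement (incl)

theorem mem_logDer_iff (a : Fin m → MvPolynomial (Fin n) ℂ) :
    a ∈ 𝒜.logDer ↔ ∃ b : Fin n → MvPolynomial (Fin n) ℂ,
      ∀ i, 𝒜.f i * a i + ∑ j, pderiv j (𝒜.f i) * b j = 0 := by
  classical
  have hQ : ∀ c : Fin m ⊕ Fin n → MvPolynomial (Fin n) ℂ, ∀ i, 𝒜.Q.mulVec c i =
      𝒜.f i * c (Sum.inl i) + ∑ j, pderiv j (𝒜.f i) * c (Sum.inr j) := by
    intro c i
    simp [Arrangement.Q, Matrix.mulVec, dotProduct, Matrix.diagonal_apply]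
  constructor
  · rintro ⟨c, hc, rfl⟩
    exact ⟨fun j => c (Sum.inr j), fun i => (hQ c i).symm.trans (congrFun hc i)⟩
  · rintro ⟨b, hb⟩
    refine ⟨Sum.elim a b, ?_, rfl⟩
    rw [SetLike.mem_coe, LinearMap.mem_ker]
    funext i
    exact (hQ _ i).trans (hb i)

theorem aeval_incl (p : Fin n ⊕ Fin m → ℂ) (r : MvPolynomial (Fin n) ℂ) :
    aeval p (incl n m r) = eval (p ∘ Sum.inl) r := by
  rw [incl, aeval_rename, aeval_eq_eval]

theorem mem_zeroLocus_preLikelihoodIdeal_iff (p : Fin n ⊕ Fin m → ℂ) :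
    p ∈ zeroLocus ℂ 𝒜.preLikelihoodIdeal ↔
      ∀ a ∈ 𝒜.logDer, ∑ i, eval (p ∘ Sum.inl) (a i) * p (Sum.inr i) = 0 := by
  rw [Arrangement.preLikelihoodIdeal, zeroLocus_span]
  simp only [Set.forall_mem_image, Set.mem_ofPred_eq, SetLike.mem_coe, map_sum, map_mul, aeval_incl,
    aeval_X]

/-- On the complement of the arrangement, the pre-likelihood ideal cuts out the likelihood
equations. -/
theorem mem_zeroLocus_preLikelihoodIdeal_iff_of_ne_zero (p : Fin n ⊕ Fin m → ℂ)
    (hp : ∀ i, eval (p ∘ Sum.inl) (𝒜.f i) ≠ 0) :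
    p ∈ zeroLocus ℂ 𝒜.preLikelihoodIdeal ↔ ∀ j, ∑ i, p (Sum.inr i) *
      (eval (p ∘ Sum.inl) (pderiv j (𝒜.f i)) / eval (p ∘ Sum.inl) (𝒜.f i)) = 0 := by
  classical
  rw [mem_zeroLocus_preLikelihoodIdeal_iff]
  set x := p ∘ Sum.inl
  constructor
  · intro h j
    -- The derivation `(∏ₖ fₖ) ∂ⱼ` is logarithmic; its linear form is, up to sign, `∏ₖ fₖ` times the
    -- `j`-th likelihood equation.
    let e : Fin m → MvPolynomial (Fin n) ℂ := fun i => ∏ k ∈ Finset.univ.erase i, 𝒜.f k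
    have he : ∀ i, 𝒜.f i * e i = ∏ k, 𝒜.f k := fun i =>
      Finset.mul_prod_erase _ _ (Finset.mem_univ i)
    have hmem : (fun i => -(e i * pderiv j (𝒜.f i))) ∈ 𝒜.logDer := by
      rw [mem_logDer_iff]
      refine ⟨Pi.single j (∏ k, 𝒜.f k), fun i => ?_⟩
      rw [Finset.sum_eq_single j (fun k _ hk => by simp [hk]) (by simp), Pi.single_eq_same, ← he i]
      ring
    have h1 := h _ hmem
    have hprod : eval x (∏ k, 𝒜.f k) ≠ 0 := by
      rw [map_prod]
      exact Finset.prod_ne_zero_iff.mpr fun i _ => hp i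
    refine (mul_eq_zero.mp ?_).resolve_left (neg_ne_zero.mpr hprod)
    rw [Finset.mul_sum]
    refine Eq.trans (Finset.sum_congr rfl fun i _ => ?_) h1
    have hi := hp i
    rw [map_neg, map_mul, ← he i, map_mul]
    field_simp
  · intro h a ha
    obtain ⟨b, hb⟩ := (mem_logDer_iff 𝒜 a).mp ha
    have h1 : ∀ i, eval x (a i) * p (Sum.inr i) = -∑ j, eval x (b j) *
        (p (Sum.inr i) * (eval x (pderiv j (𝒜.f i)) / eval x (𝒜.f i))) := by
      intro i
      have h2 := congrArg (eval x) (hb i)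
      rw [map_add, map_mul, map_sum, map_zero, add_eq_zero_iff_eq_neg] at h2
      have hi := hp i
      have h3 : eval x (a i) = -(∑ j, eval x (pderiv j (𝒜.f i) * b j)) / eval x (𝒜.f i) := by
        rw [← h2, mul_div_cancel_left₀ _ hi]
      rw [h3, neg_div, neg_mul, Finset.sum_div, Finset.sum_mul]
      refine congrArg Neg.neg (Finset.sum_congr rfl fun j _ => ?_)
      rw [map_mul]
      ring
    simp_rw [h1]
    rw [Finset.sum_neg_distrib, Finset.sum_comm]
    simp_rw [← Finset.mul_sum, h, mul_zero]
    simp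

/-- If `q` vanishes at the critical pairs, then multiplying it by `∏ᵢ fᵢ` and by the polynomial `h`
that forces regularity makes it vanish on all of `V(I₀)`. By the Nullstellensatz this multiple lies
in the prime `I₀`, and gentleness cancels the factor from `R`. -/
theorem likelihoodIdeal_eq_preLikelihoodIdeal (hgentle : 𝒜.IsGentle)
    (hprime : 𝒜.preLikelihoodIdeal.IsPrime) : 𝒜.likelihoodIdeal = 𝒜.preLikelihoodIdeal := by
  apply le_antisymm
  · intro q hq
    obtain ⟨h, hh, hreg⟩ := exists_ne_zero_forall_mem_regularLocus 𝒜
    have hprod : ∏ i, 𝒜.f i ≠ 0 := Finset.prod_ne_zero_iff.mpr fun i _ => 𝒜.ne_zero i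
    have hvan : incl n m ((∏ i, 𝒜.f i) * h) * q ∈
        vanishingIdeal ℂ (zeroLocus ℂ 𝒜.preLikelihoodIdeal) := by
      rw [mem_vanishingIdeal_iff]
      intro p hp
      rw [map_mul, aeval_incl, map_mul, map_prod]
      by_cases hp0 : ∀ i, eval (p ∘ Sum.inl) (𝒜.f i) ≠ 0
      · by_cases hph : eval (p ∘ Sum.inl) h = 0
        · rw [hph, mul_zero, zero_mul]
        · have hcrit : p ∈ 𝒜.criticalPairs :=
            ⟨hp0, (mem_zeroLocus_preLikelihoodIdeal_iff_of_ne_zero 𝒜 p hp0).mp hp, hreg _ hph⟩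
          rw [Arrangement.likelihoodIdeal, mem_vanishingIdeal_iff] at hq
          rw [hq p hcrit, mul_zero]
      · push Not at hp0
        obtain ⟨i, hi⟩ := hp0
        rw [Finset.prod_eq_zero (Finset.mem_univ i) hi, zero_mul, zero_mul]
    rw [IsPrime.vanishingIdeal_zeroLocus] at hvan
    rw [← hgentle]
    exact ⟨_, mul_ne_zero hprod hh, hvan⟩
  · refine le_trans (le_vanishingIdeal_zeroLocus (K := ℂ) _) (vanishingIdeal_anti_mono ?_)
    rintro p ⟨hp0, hp, -⟩
    exact (mem_zeroLocus_preLikelihoodIdeal_iff_of_ne_zero 𝒜 p hp0).mpr hp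

end

end LikelihoodArrangement

/-! ### The ML degree formula -/

theorem mainTheorem6 {n m l : ℕ} (𝒜 : LikelihoodArrangement.Arrangement n m)
    (hfree : 𝒜.IsFree) (hgentle : 𝒜.IsGentle)
    (A : Matrix (Fin m) (Fin l) (MvPolynomial (Fin n) ℂ)) (d : Fin l → ℕ)
    (hA : 𝒜.IsMinimalPresentation A d) :
    𝒜.mlDegree = ((∏ j with 0 < d j, d j : ℕ) : ℤ) := by
  open LikelihoodArrangement in
  have hli := linearIndependent_of_minimal hfree hA.homogeneous hA.span_eq hA.minimal
  obtain ⟨D, _, _, Ψ, hΨ, hker₀⟩ := exists_straightening hli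
  have hI := preLikelihoodIdeal_eq_span 𝒜 hA.span_eq
  -- Gentleness absorbs the nonzero factor from `R` left over by the straightening.
  have hker : ∀ q, MvPolynomial.constantCoeff (Ψ q) = 0 → q ∈ Ideal.span (Set.range (linForm A)) := by
    intro q hq
    rw [← hI, ← hgentle]
    obtain ⟨r, hr, h⟩ := hker₀ q hq
    exact ⟨r, hr, hI ▸ h⟩
  have hprime := isPrime_of_straightening hΨ hker
  have hL := likelihoodIdeal_eq_preLikelihoodIdeal 𝒜 hgentle (hI ▸ hprime)
  have hcodim : codim (Ideal.span (Set.range (linForm A))) = l := by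
    rw [codim, height_of_straightening hΨ hker, ENat.toNat_natCast]
  rw [Arrangement.mlDegree, hL, hI]
  refine multidegreeCoeff_sSup hcodim (isKPolynomial_of_straightening hΨ hker
    (isWeightedHomogeneous_linForm hA.homogeneous) fun j h => ?_)
  -- The bidegree of `gⱼ` is nonzero even when `d j = 0`, because its degree in `s` is `1`.
  have := DFunLike.congr_fun h 1
  simp [linDegree] at this
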